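/- **Setting.** An instance of hypergraph orientation under uncertainty with predictions consists of a finite vertex set $V$, a finite set $E$ of nonempty hyperedges $S\subseteq V$, and for each $v\in V$ an uncertainty interval $I_v$, which is either an open interval $(L_v,U_v)$ with $L_v<U_v$ (non-trivial) or a single point $\{L_v\}$ with $L_v=U_v$ (trivial), a predicted weight $\hat w_v\in I_v$, and a precise weight $w_v\in I_v$ that is not known to the algorithm. A query of $v$ reveals $w_v$ and replaces $I_v$ and $\hat w_v$ by $\{w_v\}$ and $w_v$; the *current instance* is the one obtained after all previous queries. A hyperedge $S$ is *solved* if some $v\in S$ has minimum weight in $S$ for all possible weights $w'\in\prod_u I_u$. A set $Q\subseteq V$ is *feasible* if querying $Q$ solves all hyperedges, and $\mathrm{OPT}$ is a feasible set of minimum size. A vertex is *mandatory* if it belongs to every feasible set, and *prediction mandatory* for the current instance if it would be mandatory were the predicted weights of all not yet queried vertices correct. The *hop distance* $k_h$ is the number of ordered pairs $(u,v)$ with $u\ne v$ such that $\hat w_v\le L_u<w_v$, or $w_v\le L_u<\hat w_v$, or $w_v<U_u\le\hat w_v$, or $\hat w_v<U_u\le w_v$ (with the initial intervals and predictions). A vertex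 $v\in T$ is *leftmost* in $T$ if $L_v=\min_{u\in T}L_u$. With respect to the current instance: * $v$ is *known mandatory* if it is leftmost in a not yet solved hyperedge $S$ with $I_u\subseteq I_v$ for some $u\in S\setminus\{v\}$. * $\{u,v\}$, $u\neq v$, is a *witness pair* if $u,v$ lie in a not yet solved hyperedge $S$, $I_u\cap I_v\neq\emptyset$, and $u$ or $v$ is leftmost in $S$. The *vertex cover instance* is the graph on $V$ whose edges are the witness pairs. * $\hat w_u$ *enforces* $v\ne u$ if $I_u,I_v$ are non-trivial, $\hat w_u\in I_v$, and $u,v$ lie in a not yet solved hyperedge $S$ such that $v$ is leftmost in $S$, or $u$ is leftmost in $S$ and $v$ is leftmost in $S\setminus\{u\}$. **Algorithm 1** (parameter $\gamma\in\mathbb N$, $\gamma\ge2$; all choices left open are arbitrary). "Clean up" means: while there is a known mandatory vertex, query one. 1. Clean up. 2. Repeat the following until the current instance has no prediction mandatory vertex: (a) Set $Q=\emptyset$. While there is a prediction mandatory vertex and $|Q|<\gamma-2$: query a prediction mandatory vertex, add it to $Q$, and clean up. (b) If there are distinct $u,v,x$ such that $\hat w_u$ enforces $v$ and $\{u,x\}$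 is a witness pair, choose such a triple, query $u$ and $x$, and then query $v$ if $w_u\in I_v$. Otherwise, if there are $u,v$ such that $\hat w_u$ enforces $v$, choose such a pair and query $v$. (c) Clean up. 3. Compute a minimum vertex cover of the current vertex cover instance and query all its vertices. Clean up. **Theorem 3.1.** Let $\gamma\ge2$ be an integer. On every instance, and for every way of making the open choices, Algorithm 1 terminates, the set of vertices it queries is feasible, and the number of its queries is at most $$\min\Big\{\Big(1+\frac1\gamma\Big)\Big(1+\frac{k_h}{|\mathrm{OPT}|}\Big),\ \gamma\Big\}\cdot|\mathrm{OPT}|.$$ If $\gamma=2$, the number of its queries is at most $\min\{1.5+k_h/|\mathrm{OPT}|,\,2\}\cdot|\mathrm{OPT}|$. (If $|\mathrm{OPT}|=0$, both bounds are read as $0$: the algorithm makes no query.) -/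

import Mathlib

universe u

/-! ## Hypergraph orientation under uncertainty, with predictions -/

/-- The publicly known data of an instance: hyperedges, lower and upper limits of the uncertainty
intervals, and predicted weights. The precise weights are not part of this data. The same type
describes the current instance after some queries; a vertex whose weight is known has equal
limits (a trivial interval). -/
structure UncertainInstance (V : Type u) where
  edges : Finset (Finset V)
  lo : V → ℝ
  hi : V → ℝ
  pred : V → ℝ

namespace UncertainInstance

variable {V : Type u}

/-- The uncertainty interval of `v`: the point `{L_v}` if trivial, otherwise the open interval
`(L_v, U_v)`. -/
def interval (I : UncertainInstance V) (v : V) : Set ℝ :=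
  {x | (I.lo v = I.hi v ∧ x = I.lo v) ∨ (I.lo v < x ∧ x < I.hi v)}

/-- `v` has a non-trivial uncertainty interval. -/
def Nontrivial (I : UncertainInstance V) (v : V) : Prop := I.lo v < I.hi v

/-- `w` is a possible assignment of precise weights. -/
def Consistent (I : UncertainInstance V) (w : V → ℝ) : Prop :=
  ∀ v, w v ∈ I.interval v

/-- A legitimate input: hyperedges are nonempty and the predictions lie in the intervals (so that
in particular the intervals are nonempty). -/
def WellFormed (I : UncertainInstance V) : Prop :=
  (∀ S ∈ I.edges, S.Nonempty) ∧ I.Consistent I.pred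

/-- The current instance after querying all vertices of `Q` when the precise weights are `w`:
the interval of a queried vertex becomes `[w_v]`, and its weight is no longer predicted but
known. -/
def reveal [DecidableEq V] (I : UncertainInstance V) (w : V → ℝ) (Q : Finset V) :
    UncertainInstance V where
  edges := I.edges
  lo v := if v ∈ Q then w v else I.lo v
  hi v := if v ∈ Q then w v else I.hi v
  pred v := if v ∈ Q then w v else I.pred v

/-- The orientation of `S` is known: some vertex of `S` is certain to have minimum weight in `S`,
whatever the still unknown weights are. -/
def EdgeSolved (I : UncertainInstance V) (S : Finset V) : Prop :=
  ∃ v ∈ S, ∀ w, I.Consistent w → ∀ u ∈ S, w v ≤ w u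

/-- Every hyperedge can be oriented. -/
def Solved (I : UncertainInstance V) : Prop := ∀ S ∈ I.edges, I.EdgeSolved S

/-- `Q` is a feasible query set for the precise weights `w`. -/
def Feasible [DecidableEq V] (I : UncertainInstance V) (w : V → ℝ) (Q : Finset V) : Prop :=
  (I.reveal w Q).Solved

/-- `Q` is an optimal query set: a feasible query set of minimum size. -/
def IsOptimal [DecidableEq V] (I : UncertainInstance V) (w : V → ℝ) (Q : Finset V) : Prop :=
  I.Feasible w Q ∧ ∀ R, I.Feasible w R → Q.card ≤ R.card

/-- `v` belongs to every feasible query set for the precise weights `w`. -/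
def Mandatory [DecidableEq V] (I : UncertainInstance V) (w : V → ℝ) (v : V) : Prop :=
  ∀ Q, I.Feasible w Q → v ∈ Q

/-- `v` is prediction mandatory: it is mandatory if all predicted weights are correct. (In a
current instance, `pred` is the precise weight on the vertices queried before.) -/
def PredMandatory [DecidableEq V] (I : UncertainInstance V) (v : V) : Prop :=
  I.Mandatory I.pred v

/-- `v` is leftmost in `S`: it is a vertex of minimum lower limit in `S`. -/
def Leftmost (I : UncertainInstance V) (v : V) (S : Finset V) : Prop :=
  v ∈ S ∧ ∀ u ∈ S, I.lo v ≤ I.lo u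

/-- `v` is known to be mandatory: it is leftmost in a not yet solved hyperedge, and `I_v` contains
the interval (hence the precise weight) of another vertex of that hyperedge. -/
def KnownMandatory (I : UncertainInstance V) (v : V) : Prop :=
  ∃ S ∈ I.edges, ¬ I.EdgeSolved S ∧ I.Leftmost v S ∧
    ∃ u ∈ S, u ≠ v ∧ I.interval u ⊆ I.interval v

/-- `{u, v}` is recognised as a witness pair: `u` and `v` lie in a common not yet solved hyperedge,
their intervals intersect, and one of them is leftmost in the hyperedge. -/
def WitnessPair (I : UncertainInstance V) (u v : V) : Prop :=
  u ≠ v ∧ ∃ S ∈ I.edges, ¬ I.EdgeSolved S ∧ u ∈ S ∧ v ∈ S ∧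
    (I.interval u ∩ I.interval v).Nonempty ∧ (I.Leftmost u S ∨ I.Leftmost v S)

/-- The predicted weight of `u` enforces `v`. -/
def Enforces [DecidableEq V] (I : UncertainInstance V) (u v : V) : Prop :=
  u ≠ v ∧ I.Nontrivial u ∧ I.Nontrivial v ∧ I.pred u ∈ I.interval v ∧
    ∃ S ∈ I.edges, ¬ I.EdgeSolved S ∧ u ∈ S ∧ v ∈ S ∧
      (I.Leftmost v S ∨ (I.Leftmost u S ∧ I.Leftmost v (S.erase u)))

/-- The vertex cover instance: vertices `u ≠ v` are adjacent iff they lie in a common not yet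
solved hyperedge in which one of them is leftmost, and their intervals intersect. -/
def coverGraph (I : UncertainInstance V) : SimpleGraph V where
  Adj u v := I.WitnessPair u v
  symm := ⟨by
    rintro u v ⟨hne, S, hS, hns, hu, hv, hint, hl⟩
    exact ⟨hne.symm, S, hS, hns, hv, hu, by rwa [Set.inter_comm], hl.symm⟩⟩
  loopless := ⟨fun _ h => h.1 rfl⟩

/-- `R` is a minimum vertex cover of the vertex cover instance. -/
def IsMinCover (I : UncertainInstance V) (R : Finset V) : Prop :=
  I.coverGraph.IsVertexCover (R : Set V) ∧
    ∀ R' : Finset V, I.coverGraph.IsVertexCover (R' : Set V) → R.card ≤ R'.card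

/-- The relation of the weight of `v` to the interval of `u` is not accurately predicted
(`k_u(v) = 1`). -/
def Hop (I : UncertainInstance V) (w : V → ℝ) (u v : V) : Prop :=
  (I.pred v ≤ I.lo u ∧ I.lo u < w v) ∨ (w v ≤ I.lo u ∧ I.lo u < I.pred v) ∨
    (w v < I.hi u ∧ I.hi u ≤ I.pred v) ∨ (I.pred v < I.hi u ∧ I.hi u ≤ w v)

open Classical in
/-- The hop distance `k_h = ∑_v ∑_{u ≠ v} k_u(v)`. -/
noncomputable def hopDistance [Fintype V] (I : UncertainInstance V) (w : V → ℝ) : ℕ :=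
  ∑ v : V, ∑ u ∈ Finset.univ.erase v, if I.Hop w u v then 1 else 0

end UncertainInstance

/-! ## Adaptive query algorithms -/

/-- An adaptive query algorithm with control states. `trans s I q s'` says that in state `s`, seeing
the current instance `I`, the algorithm may move to the state `s'`, and by doing so it queries `v`
if `q = some v`, and makes no query if `q = none`. Its behaviour depends on the precise weights
only through the current instance, that is, through the answers to earlier queries. Several
possible moves mean that the choice is left open. -/
structure QueryAlgorithm (V : Type u) where
  State : Type u
  start : State
  halted : State
  trans : State → UncertainInstance V → Option V → State → Prop

namespace QueryAlgorithm

variable {V : Type u}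

/-- A configuration of an execution: the control state and the list of all queries made so far. -/
structure Config (A : QueryAlgorithm V) where
  state : A.State
  asked : List V

/-- The initial configuration. -/
def init (A : QueryAlgorithm V) : A.Config := ⟨A.start, []⟩

/-- One step of an execution on the instance `I` with (hidden) precise weights `w`. -/
def Step [DecidableEq V] (A : QueryAlgorithm V) (I : UncertainInstance V) (w : V → ℝ)
    (c c' : A.Config) : Prop :=
  ∃ q : Option V, A.trans c.state (I.reveal w c.asked.toFinset) q c'.state ∧
    c'.asked = q.toList ++ c.asked

/-- However open choices are made, the execution of `A` on the instance `I` with precise weights `w`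
is finite, never gets stuck before the halting state, and when it halts, the queries that were made
form a feasible query set and their number (counted with repetitions) is at most `b`. -/
def SolvesWithin [DecidableEq V] (A : QueryAlgorithm V) (I : UncertainInstance V) (w : V → ℝ)
    (b : ℝ) : Prop :=
  Acc (fun c' c => A.Step I w c c') A.init ∧
  ∀ c, Relation.ReflTransGen (A.Step I w) A.init c →
    (c.state ≠ A.halted → ∃ c', A.Step I w c c') ∧
    (c.state = A.halted → I.Feasible w c.asked.toFinset ∧ (c.asked.length : ℝ) ≤ b)

end QueryAlgorithm

/-! ## The algorithm for the hop distance -/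

/-- Control states of the algorithm. -/
inductive HopState (V : Type u) : Type u
  /-- first loop that queries known mandatory vertices -/
  | initMand
  /-- test of the inner while-loop of the repeat-loop, with the set `Q` of that iteration -/
  | predPhase (Q : Finset V)
  /-- loop that queries known mandatory vertices, inside the inner while-loop -/
  | predMand (Q : Finset V)
  /-- the if-statement of the repeat-loop -/
  | branch
  /-- `u` has been queried, `w` is queried next, and `v` may follow -/
  | askSecond (u v w : V)
  /-- `u` and `w` have been queried; `v` is queried if the weight of `u` lies in `I_v` -/
  | askThird (u v : V)
  /-- loop that queries known mandatory vertices, at the end of the repeat-loop -/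
  | loopMand
  /-- the exit test of the repeat-loop -/
  | loopTest
  /-- computation of a minimum vertex cover -/
  | coverStart
  /-- `R` is the part of the vertex cover that remains to be queried -/
  | cover (R : Finset V)
  /-- last loop that queries known mandatory vertices -/
  | finalMand
  | halted

/-- The moves of the algorithm with parameter `γ`; `I` is the current instance. -/
inductive HopTrans {V : Type u} [DecidableEq V] (γ : ℕ) :
    HopState V → UncertainInstance V → Option V → HopState V → Prop
  | init_query {I v} : I.KnownMandatory v → HopTrans γ .initMand I (some v) .initMand
  | init_exit {I} : (¬ ∃ v, I.KnownMandatory v) → HopTrans γ .initMand I none (.predPhase ∅)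
  | pred_query {I Q u} : I.PredMandatory u → Q.card + 2 < γ →
      HopTrans γ (.predPhase Q) I (some u) (.predMand (insert u Q))
  | pred_exit {I Q} : ¬ ((∃ u, I.PredMandatory u) ∧ Q.card + 2 < γ) →
      HopTrans γ (.predPhase Q) I none .branch
  | predMand_query {I Q v} : I.KnownMandatory v →
      HopTrans γ (.predMand Q) I (some v) (.predMand Q)
  | predMand_exit {I Q} : (¬ ∃ v, I.KnownMandatory v) →
      HopTrans γ (.predMand Q) I none (.predPhase Q)
  | branch_triple {I u v w} : I.Enforces u v → I.WitnessPair u w → v ≠ w →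
      HopTrans γ .branch I (some u) (.askSecond u v w)
  | branch_pair {I u v} : (¬ ∃ u v w, I.Enforces u v ∧ I.WitnessPair u w ∧ v ≠ w) →
      I.Enforces u v → HopTrans γ .branch I (some v) .loopMand
  | branch_none {I} : (¬ ∃ u v, I.Enforces u v) → HopTrans γ .branch I none .loopMand
  | second_query {I u v w} : HopTrans γ (.askSecond u v w) I (some w) (.askThird u v)
  | third_query {I u v} : I.lo u ∈ I.interval v →
      HopTrans γ (.askThird u v) I (some v) .loopMand
  | third_skip {I u v} : I.lo u ∉ I.interval v →
      HopTrans γ (.askThird u v) I none .loopMand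
  | loopMand_query {I v} : I.KnownMandatory v → HopTrans γ .loopMand I (some v) .loopMand
  | loopMand_exit {I} : (¬ ∃ v, I.KnownMandatory v) → HopTrans γ .loopMand I none .loopTest
  | loop_again {I} : (∃ v, I.PredMandatory v) → HopTrans γ .loopTest I none (.predPhase ∅)
  | loop_exit {I} : (¬ ∃ v, I.PredMandatory v) → HopTrans γ .loopTest I none .coverStart
  | cover_start {I R} : I.IsMinCover R → HopTrans γ .coverStart I none (.cover R)
  | cover_query {I R v} : v ∈ R → HopTrans γ (.cover R) I (some v) (.cover (R.erase v))
  | cover_exit {I} : HopTrans γ (.cover ∅) I none .finalMand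
  | final_query {I v} : I.KnownMandatory v → HopTrans γ .finalMand I (some v) .finalMand
  | final_exit {I} : (¬ ∃ v, I.KnownMandatory v) → HopTrans γ .finalMand I none .halted

/-- The learning-augmented algorithm for the hop distance, with parameter `γ`. -/
def hopAlgorithm (V : Type u) [DecidableEq V] (γ : ℕ) : QueryAlgorithm V where
  State := HopState V
  start := .initMand
  halted := .halted
  trans := HopTrans γ

/-! The proof is an amortised count. Let `A` be the set of queried vertices. A vertex is live if it
lies in a witness pair; the open optimum consists of the live, unqueried vertices of `OPT`; an open
hop is a hop pair with both ends unqueried. Consistency is the inequality `Paid`: a query costs γ,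
an optimum vertex leaving the open set pays γ+1, and a hop that stops being open pays c. Robustness
is the inequality |A| + γ|open| ≤ γ|OPT|; within an iteration it may be violated by a debt of at
most γ-2, and once only the cover remains it is weakened to |A| + 2|open| ≤ γ|OPT|.

The structural basis is `Clean.leftmost_reveal`: between two instances without known mandatory
vertices, the leftmost vertices of unsolved hyperedges do not change. Hence no new witness pairs
arise (`Clean.witnessPair_of_reveal`), and the open optimum only shrinks.

A mandatory vertex lies in `OPT`, so querying it leaves a surplus of 1. If a prediction mandatory
vertex is not mandatory, some weight crosses a limit of its interval (`Mandatory.exists_crossing`),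
and its query closes that hop. So γ-2 prediction mandatory queries leave a surplus of γ-2, exactly
what a triple u, x, v lacks: it costs 3γ, and two optimum vertices pay 2(γ+1). If the weight of u
misses the interval of v, then v is not queried and a hop pays for the second query. If no triple
exists, v is the only witness partner of u; after querying v, either v was in `OPT`, or u was open
and ceases to be live.

When no prediction mandatory vertex is left, the open optimum is itself a vertex cover, so the
minimum cover is no larger. Every further mandatory vertex is open and has a hop of its own, which
settles both inequalities (`HopInv.halted_bounds`). -/

namespace UncertainInstance

variable {V : Type u} {J : UncertainInstance V} {p q w : V → ℝ} {u v x y z : V}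
  {S : Finset V}

/-! ### Intervals, solved hyperedges and leftmost vertices -/

theorem lo_le_of_mem {t : ℝ} (h : t ∈ J.interval v) : J.lo v ≤ t := by
  rcases h with ⟨_, h⟩ | ⟨h, _⟩ <;> linarith

theorem le_hi_of_mem {t : ℝ} (h : t ∈ J.interval v) : t ≤ J.hi v := by
  rcases h with ⟨_, h⟩ | ⟨_, h⟩ <;> linarith

theorem Nontrivial.mem_interval_iff {t : ℝ} (hv : J.Nontrivial v) :
    t ∈ J.interval v ↔ J.lo v < t ∧ t < J.hi v := by
  unfold Nontrivial at hv
  constructor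
  · rintro (⟨h, _⟩ | h)
    · linarith
    · exact h
  · exact Or.inr

theorem Consistent.lo_le (hp : J.Consistent p) (v : V) : J.lo v ≤ p v := lo_le_of_mem (hp v)

theorem Consistent.le_hi (hp : J.Consistent p) (v : V) : p v ≤ J.hi v := le_hi_of_mem (hp v)

theorem Consistent.lo_le_hi (hp : J.Consistent p) (v : V) : J.lo v ≤ J.hi v :=
  (hp.lo_le v).trans (hp.le_hi v)

theorem Consistent.lo_lt (hp : J.Consistent p) (hv : J.Nontrivial v) : J.lo v < p v :=
  (hv.mem_interval_iff.1 (hp v)).1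

theorem Consistent.lt_hi (hp : J.Consistent p) (hv : J.Nontrivial v) : p v < J.hi v :=
  (hv.mem_interval_iff.1 (hp v)).2

theorem Consistent.eq_of_not_nontrivial (hp : J.Consistent p) (hv : ¬ J.Nontrivial v) :
    J.hi v = J.lo v :=
  le_antisymm (not_lt.1 hv) (hp.lo_le_hi v)

theorem exists_mem_interval_gt (h : J.lo v ≤ J.hi v) {t : ℝ} (ht : t < J.hi v) :
    ∃ s ∈ J.interval v, t < s := by
  rcases h.eq_or_lt with h | h
  · exact ⟨J.lo v, Or.inl ⟨h, rfl⟩, by linarith⟩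
  · obtain ⟨s, hs, hs'⟩ := exists_between (max_lt ht h)
    exact ⟨s, Or.inr ⟨(le_max_right _ _).trans_lt hs, hs'⟩, (le_max_left _ _).trans_lt hs⟩

theorem exists_mem_interval_lt (h : J.lo v ≤ J.hi v) {t : ℝ} (ht : J.lo v < t) :
    ∃ s ∈ J.interval v, s < t := by
  rcases h.eq_or_lt with h | h
  · exact ⟨J.lo v, Or.inl ⟨h, rfl⟩, by linarith⟩
  · obtain ⟨s, hs, hs'⟩ := exists_between (lt_min ht h)
    exact ⟨s, Or.inr ⟨hs, hs'.trans_le (min_le_right _ _)⟩, hs'.trans_le (min_le_left _ _)⟩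

/-- A hyperedge is solved iff the interval of one vertex lies to the left of all others. -/
theorem edgeSolved_iff (hp : J.Consistent p) :
    J.EdgeSolved S ↔ ∃ v ∈ S, ∀ u ∈ S, u ≠ v → J.hi v ≤ J.lo u := by
  classical
  constructor
  · rintro ⟨v, hv, h⟩
    refine ⟨v, hv, fun u hu huv => ?_⟩
    by_contra! hlt
    -- Separate by m: a weight of `v` above m and a weight of `u` below m are possible together.
    obtain ⟨m, hm, hm'⟩ := exists_between hlt
    obtain ⟨s, hs, hms⟩ := exists_mem_interval_gt (hp.lo_le_hi v) hm'
    obtain ⟨t, ht, htm⟩ := exists_mem_interval_lt (hp.lo_le_hi u) hm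
    have := h (Function.update (Function.update p v s) u t) (fun y => by
      by_cases hyu : y = u
      · subst hyu; simpa using ht
      · by_cases hyv : y = v
        · subst hyv; simpa [hyu] using hs
        · simpa [hyu, hyv] using hp y) u hu
    rw [Function.update_self, Function.update_of_ne huv.symm, Function.update_self] at this
    linarith
  · rintro ⟨v, hv, h⟩
    refine ⟨v, hv, fun w hw u hu => ?_⟩
    by_cases huv : u = v
    · rw [huv]
    · exact (hw.le_hi v).trans ((h u hu huv).trans (hw.lo_le u))

theorem exists_leftmost (J : UncertainInstance V) (hS : S.Nonempty) : ∃ v, J.Leftmost v S :=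
  S.exists_min_image J.lo hS

theorem Leftmost.nontrivial (hp : J.Consistent p) (hv : J.Leftmost v S)
    (hS : ¬ J.EdgeSolved S) : J.Nontrivial v := by
  by_contra h
  exact hS ((edgeSolved_iff hp).2 ⟨v, hv.1, fun u hu _ =>
    (hp.eq_of_not_nontrivial h).trans_le (hv.2 u hu)⟩)

theorem Leftmost.exists_lo_lt_hi (hp : J.Consistent p) (hv : J.Leftmost v S)
    (hS : ¬ J.EdgeSolved S) : ∃ u ∈ S, u ≠ v ∧ J.lo u < J.hi v := by
  by_contra! h
  exact hS ((edgeSolved_iff hp).2 ⟨v, hv.1, h⟩)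

/-- The weights in an unsolved hyperedge exceed its minimum lower limit. -/
theorem Leftmost.lo_lt (hp : J.Consistent p) (hv : J.Leftmost v S) (hS : ¬ J.EdgeSolved S)
    (hx : x ∈ S) : J.lo v < p x := by
  by_cases hn : J.Nontrivial x
  · exact (hv.2 x hx).trans_lt (hp.lo_lt hn)
  -- A trivial vertex is not leftmost in an unsolved hyperedge, so its lower limit is already
  -- strictly larger.
  · have hne : ¬ J.Leftmost x S := fun h => hn (h.nontrivial hp hS)
    have : J.lo v < J.lo x := by
      by_contra! hle
      exact hne ⟨hx, fun y hy => hle.trans (hv.2 y hy)⟩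
    exact this.trans_le (hp.lo_le x)

/-- The interval of `v` contains a point in common with that of `u`, if `v` is leftmost. -/
theorem Leftmost.inter_nonempty (hp : J.Consistent p) (hv : J.Leftmost v S)
    (hS : ¬ J.EdgeSolved S) (hu : u ∈ S) (h : J.lo u < J.hi v) :
    (J.interval u ∩ J.interval v).Nonempty := by
  have hn := hv.nontrivial hp hS
  by_cases hnu : J.Nontrivial u
  · obtain ⟨s, hs, hs'⟩ := exists_mem_interval_lt (hp.lo_le_hi u) h
    refine ⟨s, hs, hn.mem_interval_iff.2 ⟨?_, hs'⟩⟩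
    exact (hv.2 u hu).trans_lt (hnu.mem_interval_iff.1 hs).1
  · refine ⟨p u, hp u, hn.mem_interval_iff.2 ⟨hv.lo_lt hp hS hu, ?_⟩⟩
    exact (hp.le_hi u).trans_lt (by rwa [hp.eq_of_not_nontrivial hnu])

theorem lo_lt_hi_of_inter (hn : J.Nontrivial v)
    (h : (J.interval u ∩ J.interval v).Nonempty) : J.lo u < J.hi v := by
  obtain ⟨s, hs, hs'⟩ := h
  exact (lo_le_of_mem hs).trans_lt (hn.mem_interval_iff.1 hs').2

/-! ### Queries -/

section Reveal

variable [DecidableEq V] {A B Q R : Finset V}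

theorem reveal_reveal (J : UncertainInstance V) (w : V → ℝ) (A B : Finset V) :
    (J.reveal w A).reveal w B = J.reveal w (A ∪ B) := by
  unfold reveal
  congr 1 <;> funext v <;> by_cases hA : v ∈ A <;> by_cases hB : v ∈ B <;> simp [hA, hB]

theorem reveal_eq_of_subset (J : UncertainInstance V) (w : V → ℝ) (h : A ⊆ B) :
    J.reveal w B = (J.reveal w A).reveal w B := by
  rw [reveal_reveal, Finset.union_eq_right.2 h]

theorem Consistent.reveal (hp : J.Consistent p) (hpw : ∀ v ∈ A, p v = w v) :
    (J.reveal w A).Consistent p := by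
  intro v
  by_cases hv : v ∈ A
  · exact Or.inl (by simp [UncertainInstance.reveal, hv, hpw v hv])
  · simpa [UncertainInstance.reveal, interval, hv] using hp v

theorem Consistent.reveal_self (hw : J.Consistent w) (A : Finset V) :
    (J.reveal w A).Consistent w :=
  hw.reveal fun _ _ => rfl

theorem Consistent.reveal_pred (hp : J.Consistent J.pred) (w : V → ℝ) (A : Finset V) :
    (J.reveal w A).Consistent (J.reveal w A).pred := by
  intro v
  by_cases hv : v ∈ A
  · exact Or.inl (by simp [UncertainInstance.reveal, hv])
  · simpa [UncertainInstance.reveal, interval, hv] using hp v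

theorem Nontrivial.notMem (h : (J.reveal w A).Nontrivial v) : v ∉ A := by
  intro hv
  simp [Nontrivial, UncertainInstance.reveal, hv] at h

theorem Consistent.reveal_interval_subset (hw : J.Consistent w) (v : V) :
    (J.reveal w A).interval v ⊆ J.interval v := by
  intro t ht
  by_cases hv : v ∈ A
  · simp only [UncertainInstance.reveal, interval, hv, if_true, true_and, Set.mem_ofPred_eq] at ht
    rcases ht with h | ⟨h, h'⟩
    · exact h ▸ hw v
    · exact absurd (h.trans h') (lt_irrefl _)
  · simpa [UncertainInstance.reveal, interval, hv] using ht

theorem reveal_lo_of_notMem (hv : v ∉ A) : (J.reveal w A).lo v = J.lo v := by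
  simp [reveal, hv]

theorem reveal_hi_of_notMem (hv : v ∉ A) : (J.reveal w A).hi v = J.hi v := by
  simp [reveal, hv]

theorem reveal_pred_of_notMem (hv : v ∉ A) : (J.reveal w A).pred v = J.pred v := by
  simp [reveal, hv]

theorem reveal_lo_of_mem (hv : v ∈ A) : (J.reveal w A).lo v = w v := by
  simp [reveal, hv]

theorem reveal_hi_of_mem (hv : v ∈ A) : (J.reveal w A).hi v = w v := by
  simp [reveal, hv]

theorem reveal_pred_of_mem (hv : v ∈ A) : (J.reveal w A).pred v = w v := by
  simp [reveal, hv]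

theorem EdgeSolved.reveal (hw : J.Consistent w) (h : J.EdgeSolved S) (A : Finset V) :
    (J.reveal w A).EdgeSolved S := by
  obtain ⟨v, hv, h⟩ := h
  exact ⟨v, hv, fun p hp => h p fun y => hw.reveal_interval_subset y (hp y)⟩

theorem Feasible.mono (hw : J.Consistent w) (h : J.Feasible w Q) (hQ : Q ⊆ R) :
    J.Feasible w R := by
  intro S hS
  rw [reveal_eq_of_subset J w hQ]
  exact (h S hS).reveal (hw.reveal_self Q) R

theorem Feasible.reveal (hw : J.Consistent w) (h : J.Feasible w Q) (A : Finset V) :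
    (J.reveal w A).Feasible w Q := by
  unfold Feasible
  rw [reveal_reveal]
  exact h.mono hw Finset.subset_union_right

theorem Mandatory.of_reveal (hw : J.Consistent w) (h : (J.reveal w A).Mandatory w v) :
    J.Mandatory w v :=
  fun _ hQ => h _ (hQ.reveal hw A)

/-- `v` is mandatory iff the minimum weight of the other vertices of some hyperedge lies in its
interval. -/
theorem mandatory_iff [Fintype V] (hne : ∀ S ∈ J.edges, S.Nonempty) (hp : J.Consistent p) :
    J.Mandatory p v ↔ ∃ S ∈ J.edges, v ∈ S ∧ (∃ u ∈ S, u ≠ v ∧ p u < J.hi v) ∧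
      ∀ x ∈ S, x ≠ v → J.lo v < p x := by
  constructor
  · intro h
    -- Test the set of all vertices except `v`: it must leave some hyperedge unsolved, and there
    -- only the interval of `v` is uncertain.
    have hQ : ¬ J.Feasible p (Finset.univ.erase v) := fun hf => by simpa using h _ hf
    have hlo : ∀ x, x ≠ v → (J.reveal p (Finset.univ.erase v)).lo x = p x :=
      fun x hx => reveal_lo_of_mem (by simpa using hx)
    have hhi : ∀ x, x ≠ v → (J.reveal p (Finset.univ.erase v)).hi x = p x :=
      fun x hx => reveal_hi_of_mem (by simpa using hx)
    have hlov : (J.reveal p (Finset.univ.erase v)).lo v = J.lo v := reveal_lo_of_notMem (by simp)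
    have hhiv : (J.reveal p (Finset.univ.erase v)).hi v = J.hi v := reveal_hi_of_notMem (by simp)
    simp only [Feasible, Solved, not_forall] at hQ
    obtain ⟨S, hS, hns⟩ := hQ
    rw [edgeSolved_iff (hp.reveal_self _)] at hns
    push Not at hns
    have hSne := hne S hS
    by_cases he : (S.erase v).Nonempty
    · obtain ⟨z, hz, hmin⟩ := (S.erase v).exists_min_image p he
      obtain ⟨hzv, hzS⟩ := Finset.mem_erase.1 hz
      obtain ⟨y, hy, hyz, hlt⟩ := hns z hzS
      rw [hhi z hzv] at hlt
      have hyv : y = v := by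
        by_contra hyv
        rw [hlo y hyv] at hlt
        exact absurd (hmin y (Finset.mem_erase.2 ⟨hyv, hy⟩)) (not_le.2 hlt)
      subst hyv
      rw [hlov] at hlt
      obtain ⟨u, hu, huy, hlt'⟩ := hns y hy
      rw [hhiv, hlo u huy] at hlt'
      exact ⟨S, hS, hy, ⟨u, hu, huy, hlt'⟩, fun x hx hxy =>
        hlt.trans_le (hmin x (Finset.mem_erase.2 ⟨hxy, hx⟩))⟩
    · obtain ⟨y, hy⟩ := hSne
      obtain ⟨x, hx, hxy, -⟩ := hns y hy
      exfalso
      by_cases hyv : y = v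
      · exact he ⟨x, Finset.mem_erase.2 ⟨hyv ▸ hxy, hx⟩⟩
      · exact he ⟨y, Finset.mem_erase.2 ⟨hyv, hy⟩⟩
  · rintro ⟨S, hS, hv, ⟨u, hu, huv, hlt⟩, hlo⟩ Q hQ
    by_contra hvQ
    obtain ⟨z, hz, h⟩ := (edgeSolved_iff (hp.reveal_self Q)).1 (hQ S hS)
    by_cases hzv : z = v
    · have h1 := h u hu (hzv ▸ huv)
      rw [hzv, reveal_hi_of_notMem hvQ] at h1
      linarith [(hp.reveal_self Q).lo_le u]
    · have h1 := h v hv (Ne.symm hzv)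
      rw [reveal_lo_of_notMem hvQ] at h1
      linarith [(hp.reveal_self Q).le_hi z, hlo z hz hzv]

theorem Mandatory.nontrivial [Fintype V] (hne : ∀ S ∈ J.edges, S.Nonempty) (hp : J.Consistent p)
    (h : J.Mandatory p v) : J.Nontrivial v := by
  obtain ⟨S, -, -, ⟨u, hu, huv, hlt⟩, hlo⟩ := (mandatory_iff hne hp).1 h
  exact (hlo u hu huv).trans hlt

theorem KnownMandatory.mandatory [Fintype V] (hne : ∀ S ∈ J.edges, S.Nonempty)
    (hw : J.Consistent w) (h : J.KnownMandatory v) : J.Mandatory w v := by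
  obtain ⟨S, hS, hns, hl, u, hu, huv, hsub⟩ := h
  exact (mandatory_iff hne hw).2 ⟨S, hS, hl.1, ⟨u, hu, huv,
    ((hl.nontrivial hw hns).mem_interval_iff.1 (hsub (hw u))).2⟩, fun x hx _ => hl.lo_lt hw hns hx⟩

/-- If changing the weights makes a vertex mandatory, then the change moves some weight across a
limit of its interval. -/
theorem Mandatory.exists_crossing [Fintype V] (hne : ∀ S ∈ J.edges, S.Nonempty)
    (hp : J.Consistent p) (hq : J.Consistent q) (h : J.Mandatory p v) (h' : ¬ J.Mandatory q v) :
    ∃ u, u ≠ v ∧ ((q u ≤ J.lo v ∧ J.lo v < p u) ∨ (p u < J.hi v ∧ J.hi v ≤ q u)) := by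
  obtain ⟨S, hS, hv, ⟨u, hu, huv, hlt⟩, hlo⟩ := (mandatory_iff hne hp).1 h
  rw [mandatory_iff hne hq] at h'
  by_contra! hc
  refine h' ⟨S, hS, hv, ⟨u, hu, huv, (hc u huv).2 hlt⟩, fun x hx hxv => ?_⟩
  by_contra! hle
  exact absurd (hlo x hx hxv) (not_lt.2 ((hc x hxv).1 hle))

/-- One of the vertices of a witness pair belongs to every feasible query set. -/
theorem WitnessPair.mem_or_mem (hw : J.Consistent w) (h : J.WitnessPair u v)
    (hQ : J.Feasible w Q) : u ∈ Q ∨ v ∈ Q := by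
  -- With neither queried, `v` cannot be certified as minimum because its interval meets that of
  -- `u`. No other vertex can be certified either, because its weight exceeds the lower limit of
  -- `v`.
  have key : ∀ {u v : V} {S : Finset V}, u ≠ v → S ∈ J.edges → ¬ J.EdgeSolved S → u ∈ S →
      (J.interval u ∩ J.interval v).Nonempty → J.Leftmost v S → u ∈ Q ∨ v ∈ Q := by
    intro u v S huv hS hns hu hint hl
    by_contra! hQ'
    obtain ⟨z, hz, h⟩ := (edgeSolved_iff (hw.reveal_self Q)).1 (hQ S hS)
    by_cases hzv : z = v
    · have h1 := h u hu (hzv ▸ huv)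
      rw [hzv, reveal_hi_of_notMem hQ'.2, reveal_lo_of_notMem hQ'.1] at h1
      exact absurd (lo_lt_hi_of_inter (hl.nontrivial hw hns) hint) (not_lt.2 h1)
    · have h1 := h v hl.1 (Ne.symm hzv)
      rw [reveal_lo_of_notMem hQ'.2] at h1
      linarith [(hw.reveal_self Q).le_hi z, hl.lo_lt hw hns hz]
  obtain ⟨huv, S, hS, hns, hu, hv, hint, hl | hl⟩ := h
  · exact (key huv.symm hS hns hv (by rwa [Set.inter_comm]) hl).symm
  · exact key huv hS hns hu hint hl

end Reveal

/-! ### Instances without known mandatory vertices -/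

/-- There is no known mandatory vertex. -/
def Clean (J : UncertainInstance V) : Prop := ¬ ∃ v, J.KnownMandatory v

/-- `v` is contained in a witness pair. -/
def Live (J : UncertainInstance V) (v : V) : Prop := ∃ x, J.WitnessPair v x

theorem WitnessPair.symm (h : J.WitnessPair u v) : J.WitnessPair v u :=
  SimpleGraph.Adj.symm (G := J.coverGraph) h

theorem WitnessPair.live_left (h : J.WitnessPair u v) : J.Live u := ⟨v, h⟩

theorem WitnessPair.live_right (h : J.WitnessPair u v) : J.Live v := ⟨u, h.symm⟩

theorem Mandatory.exists_unsolved [Fintype V] [DecidableEq V]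
    (hne : ∀ S ∈ J.edges, S.Nonempty) (hp : J.Consistent p) (h : J.Mandatory p v) :
    ∃ S ∈ J.edges, ∃ z, ¬ J.EdgeSolved S ∧ J.Leftmost z S ∧ v ∈ S ∧ J.Live v ∧
      (∃ u ∈ S, u ≠ v ∧ p u < J.hi v) ∧ ∀ x ∈ S, x ≠ v → J.lo v < p x := by
  have hvn := h.nontrivial hne hp
  obtain ⟨S, hS, hv, ⟨u, hu, huv, hlt⟩, hlo⟩ := (mandatory_iff hne hp).1 h
  have hns : ¬ J.EdgeSolved S := by
    rw [edgeSolved_iff hp]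
    rintro ⟨z, hz, hz'⟩
    by_cases hzv : z = v
    · subst hzv
      linarith [hz' u hu huv, hp.lo_le u]
    · linarith [hz' v hv (Ne.symm hzv), hp.le_hi z, hlo z hz hzv]
  obtain ⟨z, hz⟩ := J.exists_leftmost (hne S hS)
  refine ⟨S, hS, z, hns, hz, hv, ?_, ⟨u, hu, huv, hlt⟩, hlo⟩
  by_cases hzv : z = v
  · subst hzv
    obtain ⟨x, hx, hxz, hlt⟩ := hz.exists_lo_lt_hi hp hns
    exact ⟨x, hxz.symm, S, hS, hns, hv, hx,
      by rw [Set.inter_comm]; exact hz.inter_nonempty hp hns hx hlt, Or.inl hz⟩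
  · exact ⟨z, Ne.symm hzv, S, hS, hns, hv, hz.1, hz.inter_nonempty hp hns hv
      ((hlo z hz.1 hzv).trans_le (hp.le_hi z)), Or.inr hz⟩

theorem exists_witnessPair (hne : ∀ S ∈ J.edges, S.Nonempty) (hw : J.Consistent w)
    (h : ¬ J.Solved) : ∃ u v, J.WitnessPair u v := by
  simp only [Solved, not_forall] at h
  obtain ⟨S, hS, hns⟩ := h
  obtain ⟨v, hv⟩ := J.exists_leftmost (hne S hS)
  obtain ⟨x, hx, hxz, hlt⟩ := hv.exists_lo_lt_hi hw hns
  exact ⟨x, v, hxz, S, hS, hns, hx, hv.1, hv.inter_nonempty hw hns hx hlt, Or.inr hv⟩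

namespace Clean

/-- Any other position nests the intervals: either `v` contains `u`, or the lower limits agree and
`u`, then leftmost too, contains `v`. Both give a known mandatory vertex. This rigid picture drives
all later arguments on clean instances. -/
theorem limits (hJ : J.Clean) (hp : J.Consistent p) (hS : S ∈ J.edges) (hns : ¬ J.EdgeSolved S)
    (hv : J.Leftmost v S) (hu : u ∈ S) (huv : u ≠ v) :
    J.hi v ≤ J.lo u ∨ (J.lo v < J.lo u ∧ J.lo u < J.hi v ∧ J.hi v < J.hi u) := by
  by_contra! hc
  obtain ⟨hlt, hc⟩ := hc
  have hvn := hv.nontrivial hp hns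
  by_cases hun : J.Nontrivial u
  · rcases le_or_gt (J.hi u) (J.hi v) with hle | hgt
    · refine hJ ⟨v, S, hS, hns, hv, u, hu, huv, fun t ht => ?_⟩
      rw [hun.mem_interval_iff] at ht
      exact hvn.mem_interval_iff.2 ⟨(hv.2 u hu).trans_lt ht.1, ht.2.trans_le hle⟩
    · have hle : J.lo u ≤ J.lo v := by
        by_contra! h
        exact absurd (hc h hlt) (not_le.2 hgt)
      refine hJ ⟨u, S, hS, hns, ⟨hu, fun y hy => hle.trans (hv.2 y hy)⟩, v, hv.1, huv.symm,
        fun t ht => ?_⟩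
      rw [hvn.mem_interval_iff] at ht
      exact hun.mem_interval_iff.2 ⟨hle.trans_lt ht.1, ht.2.trans hgt⟩
  · refine hJ ⟨v, S, hS, hns, hv, u, hu, huv, fun t ht => ?_⟩
    have he := hp.eq_of_not_nontrivial hun
    have h1 := lo_le_of_mem ht
    have h2 := le_hi_of_mem ht
    have h3 := hp.lo_le u
    have h4 := hp.le_hi u
    have h5 := hv.lo_lt hp hns hu
    exact hvn.mem_interval_iff.2 ⟨by linarith, by linarith⟩

theorem lo_lt_lo (hJ : J.Clean) (hp : J.Consistent p) (hS : S ∈ J.edges) (hns : ¬ J.EdgeSolved S)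
    (hv : J.Leftmost v S) (hu : u ∈ S) (huv : u ≠ v) : J.lo v < J.lo u := by
  rcases hJ.limits hp hS hns hv hu huv with h | h
  · exact (show J.lo v < J.hi v from hv.nontrivial hp hns).trans_le h
  · exact h.1

theorem hi_le_hi (hJ : J.Clean) (hp : J.Consistent p) (hS : S ∈ J.edges) (hns : ¬ J.EdgeSolved S)
    (hv : J.Leftmost v S) (hu : u ∈ S) (huv : u ≠ v) : J.hi v ≤ J.hi u := by
  rcases hJ.limits hp hS hns hv hu huv with h | h
  · exact h.trans (hp.lo_le_hi u)
  · exact h.2.2.le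

theorem leftmost_unique (hJ : J.Clean) (hp : J.Consistent p) (hS : S ∈ J.edges)
    (hns : ¬ J.EdgeSolved S) (hv : J.Leftmost v S) (hu : J.Leftmost u S) : u = v := by
  by_contra h
  exact absurd (hJ.lo_lt_lo hp hS hns hv hu.1 h) (not_lt.2 (hu.2 v hv.1))

theorem nontrivial_left (hJ : J.Clean) (hp : J.Consistent p) (h : J.WitnessPair u v) :
    J.Nontrivial u := by
  obtain ⟨huv, S, hS, hns, hu, hv, hint, hl | hl⟩ := h
  · exact hl.nontrivial hp hns
  · have := lo_lt_hi_of_inter (hl.nontrivial hp hns) hint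
    rcases hJ.limits hp hS hns hl hu huv with h | h
    · exact absurd this (not_lt.2 h)
    · exact h.2.1.trans h.2.2

theorem nontrivial_of_live (hJ : J.Clean) (hp : J.Consistent p) (h : J.Live v) :
    J.Nontrivial v :=
  let ⟨_, h⟩ := h
  hJ.nontrivial_left hp h

section Reveal

variable [DecidableEq V] {B Q : Finset V}

/-- Querying a set of vertices and then all known mandatory ones does not change the leftmost
vertices of the hyperedges that remain unsolved. -/
theorem leftmost_reveal (hJ : J.Clean) (hw : J.Consistent w) (hK : (J.reveal w B).Clean)
    (hS : S ∈ J.edges) (hns : ¬ (J.reveal w B).EdgeSolved S) (hv : J.Leftmost v S) :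
    (J.reveal w B).Leftmost v S := by
  have hw' := hw.reveal_self B
  obtain ⟨z, hz⟩ := (J.reveal w B).exists_leftmost ⟨v, hv.1⟩
  by_cases hzv : z = v
  · exact hzv ▸ hz
  have hzB := (hz.nontrivial hw' hns).notMem
  have hlt := hK.lo_lt_lo hw' hS hns hz hv.1 (Ne.symm hzv)
  have hnsJ : ¬ J.EdgeSolved S := fun h => hns (h.reveal hw B)
  rw [reveal_lo_of_notMem hzB] at hlt
  -- If a queried `v` were overtaken by an unqueried `z`, its weight would lie strictly inside the
  -- interval of `z`, making `z` known mandatory.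
  by_cases hvB : v ∈ B
  · have h1 := hJ.hi_le_hi hw hS hnsJ hv hz.1 hzv
    have h2 := hw.lt_hi (hv.nontrivial hw hnsJ)
    have h3 := hK.limits hw' hS hns hz hv.1 (Ne.symm hzv)
    rw [reveal_hi_of_notMem hzB, reveal_lo_of_mem hvB, reveal_hi_of_mem hvB] at h3
    rcases h3 with h3 | ⟨-, h3, h4⟩ <;> linarith
  · rw [reveal_lo_of_notMem hvB] at hlt
    exact absurd hlt (not_lt.2 (hv.2 z hz.1))

/-- Intervals shrink, solved hyperedges stay solved, and leftmost vertices are unique and unchanged.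
So the vertex cover instance only loses edges from one clean instance to the next. -/
theorem witnessPair_of_reveal (hJ : J.Clean) (hw : J.Consistent w) (hK : (J.reveal w B).Clean)
    (h : (J.reveal w B).WitnessPair u v) : J.WitnessPair u v := by
  obtain ⟨huv, S, hS, hns, hu, hv, hint, hl⟩ := h
  obtain ⟨z, hz⟩ := J.exists_leftmost ⟨u, hu⟩
  have hz' := hJ.leftmost_reveal hw hK hS hns hz
  refine ⟨huv, S, hS, fun h => hns (h.reveal hw B), hu, hv, hint.mono
    (Set.inter_subset_inter (hw.reveal_interval_subset u) (hw.reveal_interval_subset v)), ?_⟩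
  rcases hl with hl | hl
  · exact Or.inl (hK.leftmost_unique (hw.reveal_self B) hS hns hz' hl ▸ hz)
  · exact Or.inr (hK.leftmost_unique (hw.reveal_self B) hS hns hz' hl ▸ hz)

theorem live_of_reveal (hJ : J.Clean) (hw : J.Consistent w) (hK : (J.reveal w B).Clean)
    (h : (J.reveal w B).Live v) : J.Live v :=
  let ⟨x, h⟩ := h
  ⟨x, hJ.witnessPair_of_reveal hw hK h⟩

/-- Querying a vertex cover and then all known mandatory vertices solves the instance. -/
theorem solved_of_cover (hJ : J.Clean) (hne : ∀ S ∈ J.edges, S.Nonempty) (hw : J.Consistent w)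
    (hK : (J.reveal w B).Clean) {R : Finset V} (hR : J.coverGraph.IsVertexCover (R : Set V))
    (hRB : R ⊆ B) : (J.reveal w B).Solved := by
  by_contra h
  have hw' := hw.reveal_self B
  -- The ends of a surviving witness pair are non-trivial, hence unqueried; but the pair was an edge
  -- before, so the cover contains one of them.
  obtain ⟨u, v, huv⟩ := exists_witnessPair (J := J.reveal w B) hne hw' h
  have h1 := (hK.nontrivial_left hw' huv).notMem
  have h2 := (hK.nontrivial_left hw' huv.symm).notMem
  rcases hR (show J.coverGraph.Adj u v from hJ.witnessPair_of_reveal hw hK huv) with h | h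
  · exact h1 (hRB (by simpa using h))
  · exact h2 (hRB (by simpa using h))

/-- If `v` is the only vertex forming a witness pair with `u`, then after querying `v` and all known
mandatory vertices, `u` is in no witness pair. -/
theorem not_live_of_unique (hJ : J.Clean) (hw : J.Consistent w) (hK : (J.reveal w B).Clean)
    (hu : ∀ x, J.WitnessPair u x → x = v) (hv : v ∈ B) : ¬ (J.reveal w B).Live u := by
  rintro ⟨x, hx⟩
  have := hu x (hJ.witnessPair_of_reveal hw hK hx)
  subst this
  exact (hK.nontrivial_left (hw.reveal_self B) hx.symm).notMem hv

/-- This guarantees that the branching step queries something whenever a prediction mandatory vertex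
remains. If the vertex is leftmost, a predicted weight inside its interval enforces it. Otherwise
the prediction of the leftmost vertex exceeds the second smallest lower limit, and the vertex
attaining that limit is enforced. -/
theorem exists_enforces [Fintype V] (hJ : J.Clean) (hne : ∀ S ∈ J.edges, S.Nonempty)
    (hp : J.Consistent J.pred) (h : J.PredMandatory v) : ∃ u v, J.Enforces u v := by
  have hvn := Mandatory.nontrivial hne hp h
  obtain ⟨S, hS, z, hns, hz, hv, -, ⟨u, hu, huv, hlt⟩, hlo⟩ := Mandatory.exists_unsolved hne hp h
  have hzn := hz.nontrivial hp hns
  by_cases hzv : z = v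
  · subst hzv
    refine ⟨u, z, huv, ?_, hzn, hzn.mem_interval_iff.2 ⟨hlo u hu huv, hlt⟩, S, hS, hns, hu, hv,
      Or.inl hz⟩
    rcases hJ.limits hp hS hns hz hu huv with h | h
    · linarith [hp.lo_le u]
    · exact h.2.1.trans h.2.2
  · obtain ⟨y, hy⟩ := J.exists_leftmost (S := S.erase z)
      ⟨v, Finset.mem_erase.2 ⟨Ne.symm hzv, hv⟩⟩
    obtain ⟨hyz, hyS⟩ := Finset.mem_erase.1 hy.1
    have h1 : J.lo y < J.pred z :=
      (hy.2 v (Finset.mem_erase.2 ⟨Ne.symm hzv, hv⟩)).trans_lt (hlo z hz.1 hzv)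
    have h2 := hp.lt_hi hzn
    have h3 : J.lo z < J.lo y ∧ J.lo y < J.hi z ∧ J.hi z < J.hi y := by
      rcases hJ.limits hp hS hns hz hyS hyz with h | h
      · linarith
      · exact h
    have hyn : J.Nontrivial y := h3.2.1.trans h3.2.2
    exact ⟨z, y, hyz.symm, hzn, hyn, hyn.mem_interval_iff.2 ⟨h1, h2.trans h3.2.2⟩, S, hS, hns, hz.1,
      hyS, Or.inr ⟨hz, hy⟩⟩

end Reveal

end Clean

/-! ### Enforcement and minimum vertex covers -/

section Enforces

variable [DecidableEq V]

/-- If `u` enforces `v` by its prediction, and its weight is indeed in the interval of `v`, then `v`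
is mandatory. -/
theorem Enforces.mandatory [Fintype V] (hJ : J.Clean) (hne : ∀ S ∈ J.edges, S.Nonempty)
    (hp : J.Consistent p) (h : J.Enforces u v) (huv : p u ∈ J.interval v) : J.Mandatory p v := by
  obtain ⟨hne', hun, hvn, -, S, hS, hns, hu, hv, hl⟩ := h
  rw [hvn.mem_interval_iff] at huv
  refine (mandatory_iff hne hp).2 ⟨S, hS, hv, ⟨u, hu, hne', huv.2⟩, fun x hx hxv => ?_⟩
  rcases hl with hl | ⟨hl, hl'⟩
  · exact hl.lo_lt hp hns hx
  · by_cases hxu : x = u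
    · exact hxu ▸ huv.1
    -- Here `u` is leftmost and `v` comes next. Either `x` lies to the right of `u`, whose weight
    -- already exceeds the lower limit of `v`, or `x` is non-trivial with lower limit at least that
    -- of `v`.
    rcases hJ.limits hp hS hns hl hx hxu with h | h
    · linarith [hp.lo_le x, hp.lt_hi hun]
    · exact (hl'.2 x (Finset.mem_erase.2 ⟨hxu, hx⟩)).trans_lt (hp.lo_lt (h.2.1.trans h.2.2))

theorem Enforces.witnessPair (hp : J.Consistent J.pred) (h : J.Enforces u v) :
    J.WitnessPair u v := by
  obtain ⟨hne', -, -, huv, S, hS, hns, hu, hv, hl⟩ := h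
  exact ⟨hne', S, hS, hns, hu, hv, ⟨J.pred u, hp u, huv⟩, hl.symm.imp_left And.left⟩

/-- An isolated vertex could be dropped from the cover. This ensures that no cover vertex has been
queried before. -/
theorem IsMinCover.live {R : Finset V} (hR : J.IsMinCover R) (hv : v ∈ R) : J.Live v := by
  by_contra h
  have : J.coverGraph.IsVertexCover ((R.erase v : Finset V) : Set V) := by
    intro a b hab
    have ha : a ≠ v := fun e => h (e ▸ WitnessPair.live_left hab)
    have hb : b ≠ v := fun e => h (e ▸ WitnessPair.live_right hab)
    simpa [ha, hb] using hR.1 hab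
  exact absurd (hR.2 _ this) (not_le.2 (Finset.card_erase_lt_of_mem hv))

theorem exists_isMinCover [Fintype V] (J : UncertainInstance V) : ∃ R, J.IsMinCover R := by
  classical
  obtain ⟨R, hR, hmin⟩ := (Finset.univ.filter fun R : Finset V =>
    J.coverGraph.IsVertexCover (R : Set V)).exists_min_image Finset.card
    ⟨Finset.univ, by simp [SimpleGraph.IsVertexCover]⟩
  exact ⟨R, by simpa using hR, fun R' h => hmin R' (by simpa using h)⟩

end Enforces

end UncertainInstance

/-! ### The open part of the optimum -/

namespace UncertainInstance

variable {V : Type u} [DecidableEq V] {I : UncertainInstance V} {w : V → ℝ}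
  {OPT A A' B : Finset V} {u v x y : V}

/-- A legitimate input, together with its hidden weights and a feasible query set. -/
structure Admissible (I : UncertainInstance V) (w : V → ℝ) (OPT : Finset V) : Prop where
  nonempty : ∀ S ∈ I.edges, S.Nonempty
  pred : I.Consistent I.pred
  consistent : I.Consistent w
  feasible : I.Feasible w OPT

open Classical in
/-- The vertices of `OPT` outside `A` that are in a witness pair after querying `B`. -/
noncomputable def openOpt (I : UncertainInstance V) (w : V → ℝ) (OPT B A : Finset V) : Finset V :=
  OPT.filter fun v => (I.reveal w B).Live v ∧ v ∉ A

theorem mem_openOpt : v ∈ I.openOpt w OPT B A ↔ v ∈ OPT ∧ (I.reveal w B).Live v ∧ v ∉ A := by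
  simp [openOpt]

theorem card_openOpt_add_card_le (hA : A ⊆ A') {T : Finset V} (hT : T ⊆ I.openOpt w OPT B A)
    (hTA : T ⊆ A') : (I.openOpt w OPT B A').card + T.card ≤ (I.openOpt w OPT B A).card := by
  rw [← Finset.card_union_of_disjoint]
  · refine Finset.card_le_card (Finset.union_subset (fun v hv => ?_) hT)
    rw [mem_openOpt] at hv ⊢
    exact ⟨hv.1, hv.2.1, fun h => hv.2.2 (hA h)⟩
  · exact Finset.disjoint_left.2 fun v hv hv' => (mem_openOpt.1 hv).2.2 (hTA hv')

theorem card_openOpt_le (hA : A ⊆ A') :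
    (I.openOpt w OPT B A').card ≤ (I.openOpt w OPT B A).card :=
  card_openOpt_add_card_le hA (T := ∅) (by simp) (by simp)

theorem card_openOpt_insert (hv : v ∈ I.openOpt w OPT B A) :
    (I.openOpt w OPT B (insert v A)).card + 1 ≤ (I.openOpt w OPT B A).card :=
  card_openOpt_add_card_le (Finset.subset_insert v A) (T := {v}) (by simpa using hv) (by simp)

namespace Admissible

theorem consistent_reveal (hI : I.Admissible w OPT) (A : Finset V) :
    (I.reveal w A).Consistent w :=
  hI.consistent.reveal_self A

theorem consistent_pred (hI : I.Admissible w OPT) (A : Finset V) :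
    (I.reveal w A).Consistent (I.reveal w A).pred :=
  hI.pred.reveal_pred w A

theorem mem_of_mandatory (hI : I.Admissible w OPT) (h : (I.reveal w A).Mandatory w v) :
    v ∈ OPT :=
  h _ (hI.feasible.reveal hI.consistent A)

theorem mandatory_of_subset (hI : I.Admissible w OPT) (hBA : B ⊆ A)
    (h : (I.reveal w A).Mandatory w v) : (I.reveal w B).Mandatory w v := by
  rw [reveal_eq_of_subset I w hBA] at h
  exact h.of_reveal (hI.consistent_reveal B)

theorem notMem_of_live (hI : I.Admissible w OPT) (hA : (I.reveal w A).Clean)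
    (h : (I.reveal w A).Live v) : v ∉ A :=
  (hA.nontrivial_of_live (hI.consistent_reveal A) h).notMem

theorem live_of_subset (hI : I.Admissible w OPT) (hBA : B ⊆ A) (hB : (I.reveal w B).Clean)
    (hA : (I.reveal w A).Clean) (h : (I.reveal w A).Live v) : (I.reveal w B).Live v := by
  rw [reveal_eq_of_subset I w hBA] at h hA
  exact hB.live_of_reveal (hI.consistent_reveal B) hA h

theorem openOpt_rebase (hI : I.Admissible w OPT) (hBA : B ⊆ A) (hB : (I.reveal w B).Clean)
    (hA : (I.reveal w A).Clean) : I.openOpt w OPT A A ⊆ I.openOpt w OPT B A := fun v hv => by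
  rw [mem_openOpt] at hv ⊢
  exact ⟨hv.1, hI.live_of_subset hBA hB hA hv.2.1, hv.2.2⟩

/-- In other words, the open optimum is a vertex cover. This bounds the final cover and also shows
that an optimum vertex is open as long as some vertex is live. -/
theorem mem_openOpt_or (hI : I.Admissible w OPT) (hA : (I.reveal w A).Clean)
    (h : (I.reveal w A).WitnessPair u v) :
    u ∈ I.openOpt w OPT A A ∨ v ∈ I.openOpt w OPT A A := by
  have key : ∀ {v}, v ∈ OPT → (I.reveal w A).Live v → v ∈ I.openOpt w OPT A A := fun hv hl =>
    mem_openOpt.2 ⟨hv, hl, hI.notMem_of_live hA hl⟩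
  exact (h.mem_or_mem (hI.consistent_reveal A) (hI.feasible.reveal hI.consistent A)).imp
    (key · h.live_left) (key · h.live_right)

end Admissible

theorem interval_reveal_of_notMem {J : UncertainInstance V} (hv : v ∉ A) :
    (J.reveal w A).interval v = J.interval v := by
  simp [reveal, interval, hv]

theorem Enforces.notMem_insert (huv : (I.reveal w B).Enforces u v) (hvx : v ≠ x) :
    v ∉ insert x (insert u B) := by
  simp [huv.1.symm, hvx, huv.2.2.1.notMem]

/-! ### Open hops and prediction errors -/

variable [Fintype V]

open Classical in
/-- The pairs of vertices outside `A` that contribute to the hop distance. -/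
noncomputable def openHops (I : UncertainInstance V) (w : V → ℝ) (A : Finset V) : Finset (V × V) :=
  Finset.univ.filter fun e => e.2 ≠ e.1 ∧ I.Hop w e.1 e.2 ∧ e.1 ∉ A ∧ e.2 ∉ A

theorem mem_openHops {e : V × V} :
    e ∈ I.openHops w A ↔ e.2 ≠ e.1 ∧ I.Hop w e.1 e.2 ∧ e.1 ∉ A ∧ e.2 ∉ A := by
  simp [openHops]

theorem openHops_subset (hA : A ⊆ A') : I.openHops w A' ⊆ I.openHops w A := fun e he => by
  rw [mem_openHops] at he ⊢
  exact ⟨he.1, he.2.1, fun h => he.2.2.1 (hA h), fun h => he.2.2.2 (hA h)⟩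

theorem card_openHops_le (hA : A ⊆ A') : (I.openHops w A').card ≤ (I.openHops w A).card :=
  Finset.card_le_card (openHops_subset hA)

theorem card_openHops_lt (hA : A ⊆ A') (h : (v, u) ∈ I.openHops w A) (hvu : v ∈ A' ∨ u ∈ A') :
    (I.openHops w A').card + 1 ≤ (I.openHops w A).card := by
  refine Finset.card_lt_card ((Finset.ssubset_iff_of_subset (openHops_subset hA)).2 ⟨_, h, ?_⟩)
  rw [mem_openHops]
  tauto

theorem card_openHops_le_hopDistance : (I.openHops w A).card ≤ I.hopDistance w := by
  classical
  have h : I.hopDistance w =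
      (Finset.univ.filter fun e : V × V => e.2 ≠ e.1 ∧ I.Hop w e.2 e.1).card := by
    rw [hopDistance, Finset.card_filter, ← Finset.univ_product_univ, Finset.sum_product]
    refine Finset.sum_congr rfl fun v _ => ?_
    rw [Finset.sum_congr (s₂ := Finset.univ.filter (· ≠ v)) (by ext; simp) fun _ _ => rfl,
      Finset.sum_filter]
    exact Finset.sum_congr rfl fun u _ => by simp [ite_and]
  rw [h]
  -- The double sum lists the vertex whose weight is misjudged first, while `openHops` lists the
  -- owner of the interval first.
  refine Finset.card_le_card_of_injOn Prod.swap (fun e he => ?_) Prod.swap_injective.injOn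
  have := mem_openHops.1 he
  simpa using ⟨this.1.symm, this.2.1⟩

namespace Admissible

theorem notMem_of_mandatory (hI : I.Admissible w OPT) (h : (I.reveal w A).Mandatory w v) :
    v ∉ A :=
  (Mandatory.nontrivial (J := I.reveal w A) hI.nonempty (hI.consistent_reveal A) h).notMem

theorem mandatory_of_known (hI : I.Admissible w OPT) (h : (I.reveal w A).KnownMandatory v) :
    (I.reveal w A).Mandatory w v :=
  h.mandatory hI.nonempty (hI.consistent_reveal A)

/-- Liveness is measured at the earlier set `B`, since during a clean-up the current instance is not
clean. A vertex mandatory now was mandatory at `B`, hence live there, so its query counts against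
the open set of `B`. -/
theorem mem_openOpt_of_mandatory (hI : I.Admissible w OPT) (hBA : B ⊆ A)
    (h : (I.reveal w A).Mandatory w v) : v ∈ I.openOpt w OPT B A := by
  obtain ⟨-, -, -, -, -, -, hl, -⟩ := Mandatory.exists_unsolved (J := I.reveal w B) hI.nonempty
    (hI.consistent_reveal B) (hI.mandatory_of_subset hBA h)
  exact mem_openOpt.2 ⟨hI.mem_of_mandatory h, hl, hI.notMem_of_mandatory h⟩

/-- A wrong prediction of the weight of `u` relative to the interval of `v` is a hop. -/
theorem mem_openHops_of_crossing (hv : v ∉ A) (huv : u ≠ v)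
    (h : ((I.reveal w A).pred u ≤ I.lo v ∧ I.lo v < w u) ∨
      (w u ≤ I.lo v ∧ I.lo v < (I.reveal w A).pred u) ∨
      (w u < I.hi v ∧ I.hi v ≤ (I.reveal w A).pred u) ∨
      ((I.reveal w A).pred u < I.hi v ∧ I.hi v ≤ w u)) : (v, u) ∈ I.openHops w A := by
  -- For a queried vertex the current prediction is the true weight, and nothing is crossed.
  have hu : u ∉ A := fun hu => by
    rw [reveal_pred_of_mem hu] at h
    rcases h with h | h | h | h <;> linarith
  rw [reveal_pred_of_notMem hu] at h
  exact mem_openHops.2 ⟨huv, h, hv, hu⟩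

theorem exists_hop_of_predMandatory (hI : I.Admissible w OPT)
    (h : (I.reveal w A).PredMandatory v) (h' : ¬ (I.reveal w A).Mandatory w v) :
    ∃ u, (v, u) ∈ I.openHops w A := by
  have hv := (Mandatory.nontrivial (J := I.reveal w A) hI.nonempty (hI.consistent_pred A) h).notMem
  obtain ⟨u, huv, hc⟩ := Mandatory.exists_crossing (J := I.reveal w A) hI.nonempty
    (hI.consistent_pred A) (hI.consistent_reveal A) h h'
  rw [reveal_lo_of_notMem hv, reveal_hi_of_notMem hv] at hc
  exact ⟨u, mem_openHops_of_crossing hv huv (by tauto)⟩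

theorem exists_hop_of_mandatory (hI : I.Admissible w OPT)
    (h : (I.reveal w A).Mandatory w v) (h' : ¬ (I.reveal w A).PredMandatory v) :
    ∃ u, (v, u) ∈ I.openHops w A := by
  have hv := hI.notMem_of_mandatory h
  obtain ⟨u, huv, hc⟩ := Mandatory.exists_crossing (J := I.reveal w A) hI.nonempty
    (hI.consistent_reveal A) (hI.consistent_pred A) h h'
  rw [reveal_lo_of_notMem hv, reveal_hi_of_notMem hv] at hc
  exact ⟨u, mem_openHops_of_crossing hv huv (by tauto)⟩

theorem hop_of_enforces (h : (I.reveal w A).Enforces u v)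
    (hw : w u ∉ (I.reveal w A).interval v) : (v, u) ∈ I.openHops w A := by
  obtain ⟨huv, -, hvn, hp, -⟩ := h
  have hv := hvn.notMem
  rw [hvn.mem_interval_iff, reveal_lo_of_notMem hv, reveal_hi_of_notMem hv] at hp hw
  refine mem_openHops_of_crossing hv huv ?_
  rcases le_or_gt (w u) (I.lo v) with h | h
  · exact Or.inr (Or.inl ⟨h, hp.1⟩)
  · exact Or.inr (Or.inr (Or.inr ⟨hp.2, not_lt.1 fun h' => hw ⟨h, h'⟩⟩))

theorem predMandatory_of_enforces (hI : I.Admissible w OPT) (hA : (I.reveal w A).Clean)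
    (h : (I.reveal w A).Enforces u v) : (I.reveal w A).PredMandatory v :=
  h.mandatory hA hI.nonempty (hI.consistent_pred A) h.2.2.2.1

theorem exists_enforces (hI : I.Admissible w OPT) (hA : (I.reveal w A).Clean)
    (h : (I.reveal w A).PredMandatory v) : ∃ u v, (I.reveal w A).Enforces u v :=
  hA.exists_enforces hI.nonempty (hI.consistent_pred A) h

end Admissible

/-! ### Accounting -/

/-- The amortised cost inequality relative to optimum and hop distance, with slack `s`. -/
def Paid (I : UncertainInstance V) (w : V → ℝ) (OPT : Finset V) (γ c s : ℕ) (B A : Finset V) :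
    Prop :=
  γ * A.card + s + (γ + 1) * (I.openOpt w OPT B A).card + c * (I.openHops w A).card ≤
    (γ + 1) * OPT.card + c * I.hopDistance w

/-- The amortised cost inequalities in the phase that queries the set `Q` of prediction mandatory
vertices. -/
def PredBudget (I : UncertainInstance V) (w : V → ℝ) (OPT : Finset V) (γ c : ℕ)
    (Q B A : Finset V) : Prop :=
  Q ⊆ A ∧ Q.card + 2 ≤ γ ∧ I.Paid w OPT γ c Q.card B A ∧
    A.card + γ * (I.openOpt w OPT B A).card ≤ γ * OPT.card + Q.card ∧
    (Q = ∅ ∨ 1 ≤ (I.openOpt w OPT B A).card ∨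
      A.card + γ * (I.openOpt w OPT B A).card + γ ≤ γ * OPT.card + Q.card + 1)

/-- The invariant at the branching of the main loop. -/
def BranchInv (I : UncertainInstance V) (w : V → ℝ) (OPT : Finset V) (γ c : ℕ) (A : Finset V) :
    Prop :=
  (I.reveal w A).Clean ∧ I.Paid w OPT γ c 0 A A ∧
    ((∃ u v, (I.reveal w A).Enforces u v) → I.Paid w OPT γ c (γ - 2) A A) ∧
    A.card + γ * (I.openOpt w OPT A A).card + 2 ≤ γ * OPT.card + γ ∧
    A.card + 2 * (I.openOpt w OPT A A).card ≤ γ * OPT.card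

/-- The invariant when the vertex cover is computed. -/
def CoverInv (I : UncertainInstance V) (w : V → ℝ) (OPT : Finset V) (γ c : ℕ) (A : Finset V) :
    Prop :=
  (I.reveal w A).Clean ∧ (¬ ∃ v, (I.reveal w A).PredMandatory v) ∧ I.Paid w OPT γ c 0 A A ∧
    A.card + 2 * (I.openOpt w OPT A A).card ≤ γ * OPT.card

/-- `A` results from `B` by querying the cover `R` and then only mandatory vertices. -/
def FinalInv (I : UncertainInstance V) (w : V → ℝ) (OPT : Finset V) (γ c : ℕ) (A : Finset V) :
    Prop :=
  ∃ B R, I.CoverInv w OPT γ c B ∧ (I.reveal w B).IsMinCover R ∧ B ∪ R ⊆ A ∧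
    ∀ v ∈ A, v ∉ B ∪ R → (I.reveal w B).Mandatory w v

/-- The invariant of the algorithm: `A` is the set of vertices queried so far. -/
def HopInv (I : UncertainInstance V) (w : V → ℝ) (OPT : Finset V) (γ c : ℕ) :
    HopState V → Finset V → Prop
  | .initMand, A => A ⊆ OPT
  | .predPhase Q, A => (I.reveal w A).Clean ∧ I.PredBudget w OPT γ c Q A A
  | .predMand Q, A => ∃ B ⊆ A, (I.reveal w B).Clean ∧ I.PredBudget w OPT γ c Q B A
  | .branch, A => I.BranchInv w OPT γ c A
  | .askSecond u v x, A => ∃ B, I.BranchInv w OPT γ c B ∧ A = insert u B ∧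
      (I.reveal w B).Enforces u v ∧ (I.reveal w B).WitnessPair u x ∧ v ≠ x
  | .askThird u v, A => ∃ B x, I.BranchInv w OPT γ c B ∧ A = insert x (insert u B) ∧
      (I.reveal w B).Enforces u v ∧ (I.reveal w B).WitnessPair u x ∧ v ≠ x ∧ x ∉ insert u B
  | .loopMand, A => ∃ B ⊆ A, (I.reveal w B).Clean ∧ I.Paid w OPT γ c 0 B A ∧
      (A.card + γ * (I.openOpt w OPT B A).card ≤ γ * OPT.card ∨
        (A.card + 1 + γ * (I.openOpt w OPT B A).card ≤ γ * OPT.card + γ ∧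
          ∃ u ∈ I.openOpt w OPT B A, ∃ v ∈ A, ∀ x, (I.reveal w B).WitnessPair u x → x = v) ∨
        (B = A ∧ (¬ ∃ v, (I.reveal w A).PredMandatory v) ∧
          A.card + 2 * (I.openOpt w OPT A A).card ≤ γ * OPT.card))
  | .loopTest, A => (I.reveal w A).Clean ∧ I.Paid w OPT γ c 0 A A ∧
      (A.card + γ * (I.openOpt w OPT A A).card ≤ γ * OPT.card ∨
        (¬ ∃ v, (I.reveal w A).PredMandatory v) ∧
          A.card + 2 * (I.openOpt w OPT A A).card ≤ γ * OPT.card)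
  | .coverStart, A => I.CoverInv w OPT γ c A
  | .cover R, A => ∃ B R', I.CoverInv w OPT γ c B ∧ (I.reveal w B).IsMinCover R' ∧ R ⊆ R' ∧
      A = B ∪ (R' \ R)
  | .finalMand, A => I.FinalInv w OPT γ c A
  | .halted, A => (I.reveal w A).Clean ∧ I.FinalInv w OPT γ c A

/-! ### How each kind of query preserves the cost inequalities -/

variable {γ c s t : ℕ} {Q : Finset V}

namespace Paid

theorem mono (h : I.Paid w OPT γ c s B A) (hts : t ≤ s) : I.Paid w OPT γ c t B A := by
  unfold Paid at *
  omega

theorem query_opt (h : I.Paid w OPT γ c s B A) (hv : v ∈ I.openOpt w OPT B A) :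
    I.Paid w OPT γ c (s + 1) B (insert v A) := by
  unfold Paid at *
  rw [Finset.card_insert_of_notMem (mem_openOpt.1 hv).2.2]
  have h1 := Nat.mul_le_mul_left (γ + 1) (card_openOpt_insert hv)
  have h2 := Nat.mul_le_mul_left c (card_openHops_le (I := I) (w := w) (Finset.subset_insert v A))
  linarith

theorem query_hop (h : I.Paid w OPT γ c s B A) (hv : v ∉ A)
    (hu : (v, u) ∈ I.openHops w A) (hc : γ + t ≤ c) :
    I.Paid w OPT γ c (s + t) B (insert v A) := by
  unfold Paid at *
  rw [Finset.card_insert_of_notMem hv]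
  have h1 := Nat.mul_le_mul_left (γ + 1)
    (card_openOpt_le (I := I) (w := w) (OPT := OPT) (B := B) (Finset.subset_insert v A))
  have h2 := Nat.mul_le_mul_left c
    (card_openHops_lt (Finset.subset_insert v A) hu (Or.inl (Finset.mem_insert_self v A)))
  linarith

theorem rebase (h : I.Paid w OPT γ c s B A) (hI : I.Admissible w OPT) (hBA : B ⊆ A)
    (hB : (I.reveal w B).Clean) (hA : (I.reveal w A).Clean) : I.Paid w OPT γ c s A A := by
  unfold Paid at *
  have := Nat.mul_le_mul_left (γ + 1) (Finset.card_le_card (hI.openOpt_rebase hBA hB hA))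
  linarith

end Paid

namespace PredBudget

theorem rebase (h : I.PredBudget w OPT γ c Q B A) (hI : I.Admissible w OPT) (hBA : B ⊆ A)
    (hB : (I.reveal w B).Clean) (hA : (I.reveal w A).Clean) : I.PredBudget w OPT γ c Q A A := by
  obtain ⟨hQ, hγ, hp, h1, h2⟩ := h
  have hle := Finset.card_le_card (hI.openOpt_rebase hBA hB hA)
  have h3 := Nat.mul_le_mul_left γ hle
  refine ⟨hQ, hγ, hp.rebase hI hBA hB hA, by linarith, ?_⟩
  rcases h2 with h2 | h2 | h2
  · exact Or.inl h2
  · rcases hle.eq_or_lt with he | hlt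
    · exact Or.inr (Or.inl (he ▸ h2))
    · have h4 := Nat.mul_le_mul_left γ (Nat.succ_le_of_lt hlt)
      exact Or.inr (Or.inr (by rw [Nat.succ_eq_add_one, mul_add] at h4; omega))
  · exact Or.inr (Or.inr (by linarith))

/-- One query replaces an open vertex worth γ, saving γ-1. This gives the third alternative of
`PredBudget` whichever one held before. -/
theorem query_mandatory (h : I.PredBudget w OPT γ c Q B A) (hv : v ∈ I.openOpt w OPT B A) :
    I.PredBudget w OPT γ c Q B (insert v A) := by
  obtain ⟨hQ, hγ, hp, h1, h2⟩ := h
  have h3 := Nat.mul_le_mul_left γ (card_openOpt_insert hv)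
  rw [mul_add] at h3
  have h4 := Finset.card_insert_of_notMem (mem_openOpt.1 hv).2.2
  exact ⟨hQ.trans (Finset.subset_insert v A), hγ, (hp.query_opt hv).mono (by omega), by omega,
    Or.inr (Or.inr (by omega))⟩

/-- The vertex is in `OPT` or closes a hop, so a surplus of 1 remains; this is the only place that
needs c ≥ γ+1. For robustness, the vertex is live, so an open vertex exists beforehand: it survives,
or its departure saves γ. -/
theorem query_pred (h : I.PredBudget w OPT γ c Q A A) (hI : I.Admissible w OPT)
    (hA : (I.reveal w A).Clean) (hv : (I.reveal w A).PredMandatory v) (hQγ : Q.card + 2 < γ)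
    (hc : γ + 1 ≤ c) : v ∉ A ∧ I.PredBudget w OPT γ c (insert v Q) A (insert v A) := by
  obtain ⟨hQ, hγ, hp, h1, h2⟩ := h
  obtain ⟨-, -, -, -, -, -, hl, -⟩ := Mandatory.exists_unsolved (J := I.reveal w A) hI.nonempty
    (hI.consistent_pred A) hv
  have hvA := hI.notMem_of_live hA hl
  have hle := card_openOpt_le (I := I) (w := w) (OPT := OPT) (B := A) (Finset.subset_insert v A)
  have h3 := Nat.mul_le_mul_left γ hle
  have hpos : 1 ≤ (I.openOpt w OPT A A).card := by
    obtain ⟨x, hx⟩ := hl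
    rcases hI.mem_openOpt_or hA hx with h | h <;> exact Finset.card_pos.2 ⟨_, h⟩
  refine ⟨hvA, Finset.insert_subset_insert v hQ, ?_⟩
  rw [Finset.card_insert_of_notMem hvA, Finset.card_insert_of_notMem fun h => hvA (hQ h)]
  refine ⟨hQγ, ?_, by omega, Or.inr ?_⟩
  · by_cases hm : (I.reveal w A).Mandatory w v
    · exact hp.query_opt (hI.mem_openOpt_of_mandatory subset_rfl hm)
    · obtain ⟨u, hu⟩ := hI.exists_hop_of_predMandatory hv hm
      exact hp.query_hop hvA hu hc
  · rcases hle.eq_or_lt with he | hlt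
    · exact Or.inl (he ▸ hpos)
    · have h4 := Nat.mul_le_mul_left γ (Nat.succ_le_of_lt hlt)
      exact Or.inr (by rw [Nat.succ_eq_add_one, mul_add] at h4; omega)

/-- If some enforcement exists, the inner loop can only have stopped because `Q` is full, so the
surplus is γ-2. For the factor 2 bound, the debt |Q| ≤ γ-2 is absorbed by a remaining open vertex,
worth γ-2 more than is needed, or by the γ-1 saved earlier. -/
theorem branchInv (h : I.PredBudget w OPT γ c Q A A) (hI : I.Admissible w OPT)
    (hA : (I.reveal w A).Clean)
    (hex : ¬ ((∃ u, (I.reveal w A).PredMandatory u) ∧ Q.card + 2 < γ)) :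
    I.BranchInv w OPT γ c A := by
  obtain ⟨hQ, hγ, hp, h1, h2⟩ := h
  refine ⟨hA, hp.mono (Nat.zero_le _), fun ⟨u, v, huv⟩ => hp.mono ?_, by omega, ?_⟩
  · by_contra hlt
    exact hex ⟨⟨v, hI.predMandatory_of_enforces hA huv⟩, by omega⟩
  · obtain ⟨g, rfl⟩ := Nat.exists_eq_add_of_le' (show 2 ≤ γ by omega)
    rcases h2 with h2 | h2 | h2
    · rw [h2, Finset.card_empty] at h1
      nlinarith
    · nlinarith [Nat.mul_le_mul_left g h2]
    · nlinarith

end PredBudget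

theorem CoverInv.of_loop (hγ : 2 ≤ γ) (hA : (I.reveal w A).Clean)
    (hpm : ¬ ∃ v, (I.reveal w A).PredMandatory v) (hp : I.Paid w OPT γ c 0 A A)
    (h : A.card + γ * (I.openOpt w OPT A A).card ≤ γ * OPT.card ∨
        (¬ ∃ v, (I.reveal w A).PredMandatory v) ∧
          A.card + 2 * (I.openOpt w OPT A A).card ≤ γ * OPT.card) : I.CoverInv w OPT γ c A := by
  refine ⟨hA, hpm, hp, ?_⟩
  rcases h with h | h
  · have := Nat.mul_le_mul_right (I.openOpt w OPT A A).card hγ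
    omega
  · exact h.2

/-- The query of the only witness partner of a vertex whose prediction enforces it. -/
theorem BranchInv.query_pair (h : I.BranchInv w OPT γ c A) (hI : I.Admissible w OPT)
    (hc : γ ≤ c)
    (hno : ¬ ∃ u v x, (I.reveal w A).Enforces u v ∧ (I.reveal w A).WitnessPair u x ∧ v ≠ x)
    (huv : (I.reveal w A).Enforces u v) : v ∉ A ∧ I.HopInv w OPT γ c .loopMand (insert v A) := by
  obtain ⟨hA, hp, -, h1, -⟩ := h
  have hvA := huv.2.2.1.notMem
  have hw := huv.witnessPair (hI.consistent_pred A)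
  have h2 := Finset.card_insert_of_notMem hvA
  refine ⟨hvA, A, Finset.subset_insert v A, hA, ?_⟩
  by_cases hv : v ∈ OPT
  · have hv' : v ∈ I.openOpt w OPT A A := mem_openOpt.2 ⟨hv, hw.live_right, hvA⟩
    have h3 := Nat.mul_le_mul_left γ (card_openOpt_insert hv')
    rw [mul_add] at h3
    exact ⟨(hp.query_opt hv').mono (Nat.zero_le _), Or.inl (by omega)⟩
  -- Since `v` is not mandatory, the weight of `u` misses its interval: a hop pays for the query.
  -- Robustness is repaid later, when `u` stops being live.
  · have hhop := Admissible.hop_of_enforces huv fun h =>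
      hv (hI.mem_of_mandatory (huv.mandatory hA hI.nonempty (hI.consistent_reveal A) h))
    have hu : u ∈ I.openOpt w OPT A A := (hI.mem_openOpt_or hA hw).resolve_right
      fun h => hv (mem_openOpt.1 h).1
    have h3 := Nat.mul_le_mul_left γ
      (card_openOpt_le (I := I) (w := w) (OPT := OPT) (B := A) (Finset.subset_insert v A))
    refine ⟨hp.query_hop (t := 0) hvA hhop hc, Or.inr (Or.inl ⟨by omega, u, ?_, v,
      Finset.mem_insert_self v A, fun x hx => ?_⟩)⟩
    · rw [mem_openOpt] at hu ⊢
      exact ⟨hu.1, hu.2.1, by simp [huv.1, hu.2.2]⟩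
    · by_contra hxv
      exact hno ⟨u, v, x, huv, hx, Ne.symm hxv⟩

/-- The vertex `v` is mandatory and one of `u`, `x` is in `OPT`, so two open vertices disappear. The
remaining cost 3γ - 2(γ+1) = γ-2 is the accumulated surplus. -/
theorem BranchInv.query_triple (h : I.BranchInv w OPT γ c B) (hI : I.Admissible w OPT)
    (hγ : 2 ≤ γ) (huv : (I.reveal w B).Enforces u v) (hux : (I.reveal w B).WitnessPair u x)
    (hvx : v ≠ x) (hx : x ∉ insert u B) (hm : w u ∈ I.interval v) :
    I.HopInv w OPT γ c .loopMand (insert v (insert x (insert u B))) := by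
  obtain ⟨hB, -, hp, h1, -⟩ := h
  have hp := hp ⟨u, v, huv⟩
  have huB := huv.2.1.notMem
  have hvA := huv.notMem_insert hvx
  have hsub : B ⊆ insert v (insert x (insert u B)) := fun y hy => by simp [hy]
  have hvO : v ∈ I.openOpt w OPT B B := hI.mem_openOpt_of_mandatory subset_rfl
    (huv.mandatory hB hI.nonempty (hI.consistent_reveal B)
      (by rwa [interval_reveal_of_notMem huv.2.2.1.notMem]))
  have hO : (I.openOpt w OPT B (insert v (insert x (insert u B)))).card + 2 ≤
      (I.openOpt w OPT B B).card := by
    rcases hI.mem_openOpt_or hB hux with h | h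
    · have := card_openOpt_add_card_le (I := I) (w := w) (OPT := OPT) (B := B) hsub (T := {v, u})
        (by simp [Finset.insert_subset_iff, h, hvO]) (by simp [Finset.insert_subset_iff])
      rwa [Finset.card_pair huv.1.symm] at this
    · have := card_openOpt_add_card_le (I := I) (w := w) (OPT := OPT) (B := B) hsub (T := {v, x})
        (by simp [Finset.insert_subset_iff, h, hvO]) (by simp [Finset.insert_subset_iff])
      rwa [Finset.card_pair hvx] at this
  have hH := Nat.mul_le_mul_left c (card_openHops_le (I := I) (w := w) hsub)
  have hcard : (insert v (insert x (insert u B))).card = B.card + 3 := by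
    rw [Finset.card_insert_of_notMem hvA, Finset.card_insert_of_notMem hx,
      Finset.card_insert_of_notMem huB]
  have hO1 := Nat.mul_le_mul_left γ hO
  have hO2 := Nat.mul_le_mul_left (γ + 1) hO
  refine ⟨B, hsub, hB, ?_, Or.inl ?_⟩
  · unfold Paid at hp ⊢
    rw [hcard]
    have : γ - 2 + 2 = γ := by omega
    linarith
  · rw [hcard]
    linarith

/-- The witness pair removes one open vertex, and the query of `u` closes the hop between `u` and
the interval of `v`. For robustness, two queries plus the debt γ-2 equal exactly the γ that is
freed. -/
theorem BranchInv.query_double (h : I.BranchInv w OPT γ c B) (hI : I.Admissible w OPT)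
    (hγ : 2 ≤ γ) (hc : γ ≤ c) (huv : (I.reveal w B).Enforces u v)
    (hux : (I.reveal w B).WitnessPair u x) (hx : x ∉ insert u B) (hm : w u ∉ I.interval v) :
    I.HopInv w OPT γ c .loopMand (insert x (insert u B)) := by
  obtain ⟨hB, -, hp, h1, -⟩ := h
  have hp := hp ⟨u, v, huv⟩
  have huB := huv.2.1.notMem
  have hsub : B ⊆ insert x (insert u B) := fun y hy => by simp [hy]
  have hO : (I.openOpt w OPT B (insert x (insert u B))).card + 1 ≤
      (I.openOpt w OPT B B).card := by
    rcases hI.mem_openOpt_or hB hux with h | h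
    · exact card_openOpt_add_card_le hsub (T := {u}) (by simp [h]) (by simp)
    · exact card_openOpt_add_card_le hsub (T := {x}) (by simp [h]) (by simp)
  have hH := Nat.mul_le_mul_left c (card_openHops_lt hsub (Admissible.hop_of_enforces huv
    (by rwa [interval_reveal_of_notMem huv.2.2.1.notMem])) (Or.inr (by simp)))
  have hcard : (insert x (insert u B)).card = B.card + 2 := by
    rw [Finset.card_insert_of_notMem hx, Finset.card_insert_of_notMem huB]
  have hO1 := Nat.mul_le_mul_left γ hO
  have hO2 := Nat.mul_le_mul_left (γ + 1) hO
  refine ⟨B, hsub, hB, ?_, Or.inl ?_⟩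
  · unfold Paid at hp ⊢
    rw [hcard]
    have : γ - 2 + 2 = γ := by omega
    linarith
  · rw [hcard]
    linarith

theorem HopInv.loopMand_query (h : I.HopInv w OPT γ c .loopMand A) (hI : I.Admissible w OPT)
    (hγ : 2 ≤ γ) (hv : (I.reveal w A).KnownMandatory v) :
    I.HopInv w OPT γ c .loopMand (insert v A) := by
  obtain ⟨B, hBA, hB, hp, h⟩ := h
  have hvO := hI.mem_openOpt_of_mandatory hBA (hI.mandatory_of_known hv)
  have h1 := Nat.mul_le_mul_left γ (card_openOpt_insert hvO)
  have h2 := Finset.card_insert_of_notMem (mem_openOpt.1 hvO).2.2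
  rw [mul_add] at h1
  have h3 : 1 ≤ (I.openOpt w OPT B A).card := Finset.card_pos.2 ⟨v, hvO⟩
  refine ⟨B, hBA.trans (Finset.subset_insert v A), hB, (hp.query_opt hvO).mono (Nat.zero_le _), ?_⟩
  rcases h with h | ⟨h, u, hu, y, hy, hyu⟩ | ⟨rfl, -, -⟩
  · exact Or.inl (by omega)
  -- If the mandatory vertex is `u` itself, its departure from the open set settles the deferred
  -- debt immediately.
  · by_cases huv : u = v
    · exact Or.inl (by omega)
    · refine Or.inr (Or.inl ⟨by omega, u, ?_, y, Finset.mem_insert_of_mem hy, hyu⟩)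
      rw [mem_openOpt] at hu ⊢
      exact ⟨hu.1, hu.2.1, by simp [huv, hu.2.2]⟩
  · exact absurd ⟨v, hv⟩ hB

theorem HopInv.loopMand_exit (h : I.HopInv w OPT γ c .loopMand A) (hI : I.Admissible w OPT)
    (hA : (I.reveal w A).Clean) : I.HopInv w OPT γ c .loopTest A := by
  obtain ⟨B, hBA, hB, hp, h⟩ := h
  have hsub := hI.openOpt_rebase hBA hB hA
  have h1 := Nat.mul_le_mul_left γ (Finset.card_le_card hsub)
  refine ⟨hA, hp.rebase hI hBA hB hA, ?_⟩
  rcases h with h | ⟨h, u, hu, y, hy, hyu⟩ | ⟨rfl, h⟩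
  · exact Or.inl (by omega)
  -- The deferred debt is settled here: `u` has lost its only partner and leaves the open set.
  · have hlt : (I.openOpt w OPT A A).card < (I.openOpt w OPT B A).card := by
      refine Finset.card_lt_card ((Finset.ssubset_iff_of_subset hsub).2 ⟨u, hu, fun hu' => ?_⟩)
      have hl := (mem_openOpt.1 hu').2.1
      rw [reveal_eq_of_subset I w hBA] at hl hA
      exact hB.not_live_of_unique (hI.consistent_reveal B) hA hyu hy hl
    have h2 := Nat.mul_le_mul_left γ (Nat.succ_le_of_lt hlt)
    rw [Nat.succ_eq_add_one, mul_add] at h2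
    exact Or.inl (by omega)
  · exact Or.inr h

/-- The invariant is preserved, and no vertex is queried twice. -/
theorem HopInv.step (hI : I.Admissible w OPT) (hγ : 2 ≤ γ) (hc : γ ≤ c)
    (hc' : 2 < γ → γ + 1 ≤ c) {a a' : HopState V} {q : Option V}
    (h : I.HopInv w OPT γ c a A) (ht : HopTrans γ a (I.reveal w A) q a') :
    (∀ v ∈ q, v ∉ A) ∧ I.HopInv w OPT γ c a' (q.toFinset ∪ A) := by
  have known : ∀ {v}, (I.reveal w A).KnownMandatory v → v ∉ A := fun hv =>
    hI.notMem_of_mandatory (hI.mandatory_of_known hv)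
  cases ht with
  | init_query hv =>
    refine ⟨by simpa using known hv, ?_⟩
    exact Finset.union_subset (by simpa using hI.mem_of_mandatory (hI.mandatory_of_known hv)) h
  | init_exit hA =>
    have h : A ⊆ OPT := h
    -- All queries so far are in `OPT` and the open vertices are unqueried, so the two sets are
    -- disjoint parts of `OPT`.
    have h0 : (I.openOpt w OPT A A).card + A.card ≤ OPT.card := by
      rw [← Finset.card_union_of_disjoint
        (Finset.disjoint_left.2 fun v hv => (mem_openOpt.1 hv).2.2)]
      exact Finset.card_le_card (Finset.union_subset (fun v hv => (mem_openOpt.1 hv).1) h)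
    have h1 := Nat.mul_le_mul_left γ h0
    have h2 := Nat.mul_le_mul_left (γ + 1) h0
    have h3 := Nat.mul_le_mul_left c (card_openHops_le_hopDistance (I := I) (w := w) (A := A))
    have h4 := Nat.mul_le_mul_right A.card (show 1 ≤ γ by omega)
    simp only [Option.toFinset_none, Finset.empty_union]
    refine ⟨by simp, hA, by simp, by simpa using hγ, ?_, ?_, Or.inl rfl⟩
    · unfold Paid
      rw [Finset.card_empty]
      linarith
    · rw [Finset.card_empty]
      linarith
  | pred_query hu hQ =>
    obtain ⟨h1, h2⟩ := h.2.query_pred hI h.1 hu hQ (hc' (by omega))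
    refine ⟨by simpa using h1, A, Finset.subset_union_right, h.1, ?_⟩
    simpa using h2
  | pred_exit hex => exact ⟨by simp, by simpa [HopInv] using h.2.branchInv hI h.1 hex⟩
  | predMand_query hv =>
    obtain ⟨B, hBA, hB, h⟩ := h
    refine ⟨by simpa using known hv, B, hBA.trans Finset.subset_union_right, hB, ?_⟩
    simpa using h.query_mandatory (hI.mem_openOpt_of_mandatory hBA (hI.mandatory_of_known hv))
  | predMand_exit hA =>
    obtain ⟨B, hBA, hB, h⟩ := h
    exact ⟨by simp, by simpa using ⟨hA, h.rebase hI hBA hB hA⟩⟩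
  | branch_triple huv hux hvx =>
    exact ⟨by simpa using huv.2.1.notMem, A, h, by simp, huv, hux, hvx⟩
  | branch_pair hno huv =>
    obtain ⟨h1, h2⟩ := h.query_pair hI hc hno huv
    exact ⟨by simpa using h1, by simpa using h2⟩
  | branch_none hno =>
    refine ⟨by simp, ?_⟩
    simp only [Option.toFinset_none, Finset.empty_union]
    exact ⟨A, subset_rfl, h.1, h.2.1, Or.inr (Or.inr
      ⟨rfl, fun ⟨v, hv⟩ => hno (hI.exists_enforces h.1 hv), h.2.2.2.2⟩)⟩
  | second_query =>
    obtain ⟨B, hB, rfl, huv, hux, hvx⟩ := h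
    have hx := (hB.1.nontrivial_left (hI.consistent_reveal B) hux.symm).notMem
    have hx' := hux.1.symm
    refine ⟨by simp [hx, hx'], B, _, hB, ?_, huv, hux, hvx, by simp [hx, hx']⟩
    rfl
  | third_query hm =>
    obtain ⟨B, x, hB, rfl, huv, hux, hvx, hx⟩ := h
    have hvA := huv.notMem_insert hvx
    rw [reveal_lo_of_mem (by simp), interval_reveal_of_notMem hvA] at hm
    exact ⟨by simpa using hvA, hB.query_triple hI hγ huv hux hvx hx hm⟩
  | third_skip hm =>
    obtain ⟨B, x, hB, rfl, huv, hux, hvx, hx⟩ := h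
    have hvA := huv.notMem_insert hvx
    rw [reveal_lo_of_mem (by simp), interval_reveal_of_notMem hvA] at hm
    exact ⟨by simp, by simpa using hB.query_double hI hγ hc huv hux hx hm⟩
  | loopMand_query hv =>
    exact ⟨by simpa using known hv, by simpa using h.loopMand_query hI hγ hv⟩
  | loopMand_exit hA => exact ⟨by simp, by simpa using h.loopMand_exit hI hA⟩
  | loop_again hpm =>
    obtain ⟨hA, hp, h⟩ := h
    have h := h.resolve_right fun h => h.1 hpm
    simp only [Option.toFinset_none, Finset.empty_union]
    exact ⟨by simp, hA, by simp, by simpa using hγ, by simpa using hp, by simpa using h, Or.inl rfl⟩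
  | loop_exit hpm =>
    exact ⟨by simp, by simpa [HopInv] using CoverInv.of_loop hγ h.1 hpm h.2.1 h.2.2⟩
  | cover_start hR =>
    exact ⟨by simp, A, _, h, hR, subset_rfl, by simp⟩
  | @cover_query _ R v hv =>
    obtain ⟨B, R', hB, hR', hsub, rfl⟩ := h
    refine ⟨?_, B, R', hB, hR', (Finset.erase_subset v R).trans hsub, ?_⟩
    · simpa [hv] using hI.notMem_of_live hB.1 (hR'.live (hsub hv))
    · ext y
      by_cases hy : y = v
      · subst hy
        simp [hsub hv]
      · simp [hy]
  | cover_exit =>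
    obtain ⟨B, R', hB, hR', -, rfl⟩ := h
    exact ⟨by simp, B, R', hB, hR', by simp, fun v hv hv' => absurd (by simpa using hv) hv'⟩
  | @final_query _ v hv =>
    obtain ⟨B, R, hB, hR, hsub, hm⟩ := h
    refine ⟨by simpa using known hv, B, R, hB, hR, hsub.trans Finset.subset_union_right, ?_⟩
    intro y hy hy'
    rcases Finset.mem_union.1 hy with hy | hy
    · have : y = v := by simpa using hy
      subst this
      exact hI.mandatory_of_subset (Finset.subset_union_left.trans hsub) (hI.mandatory_of_known hv)
    · exact hm y hy hy'
  | final_exit hA => exact ⟨by simp, by simpa using ⟨hA, h⟩⟩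

/-- The outcome of the algorithm. -/
theorem HopInv.halted_bounds (hI : I.Admissible w OPT) (hc : γ ≤ c)
    (h : I.HopInv w OPT γ c .halted A) :
    I.Feasible w A ∧ γ * A.card ≤ (γ + 1) * OPT.card + c * I.hopDistance w ∧
      A.card ≤ γ * OPT.card := by
  obtain ⟨hA, B, R, ⟨hB, hpm, hp, h1⟩, hR, hsub, hm⟩ := h
  have hBA := Finset.union_subset_left hsub
  -- The open optimum is a competing vertex cover.
  have hRO : R.card ≤ (I.openOpt w OPT B B).card := by
    refine hR.2 _ fun u v huv => ?_
    simpa using hI.mem_openOpt_or hB huv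
  have hMO : (A \ (B ∪ R)).card ≤ (I.openOpt w OPT B B).card := by
    refine Finset.card_le_card fun v hv => ?_
    rw [Finset.mem_sdiff] at hv
    exact hI.mem_openOpt_of_mandatory subset_rfl (hm v hv.1 hv.2)
  -- Each late mandatory vertex was not prediction mandatory at `B`, so it owns an interval with a
  -- hop; distinct vertices give distinct first coordinates.
  have hMH : (A \ (B ∪ R)).card ≤ (I.openHops w B).card := by
    refine (Finset.card_le_card (t := (I.openHops w B).image Prod.fst) fun v hv => ?_).trans
      Finset.card_image_le
    rw [Finset.mem_sdiff] at hv
    obtain ⟨u, hu⟩ := hI.exists_hop_of_mandatory (hm v hv.1 hv.2) fun h => hpm ⟨v, h⟩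
    exact Finset.mem_image.2 ⟨_, hu, rfl⟩
  have hcard : A.card ≤ B.card + R.card + (A \ (B ∪ R)).card := by
    have := Finset.card_sdiff_add_card_eq_card hsub
    have := Finset.card_union_le B R
    omega
  refine ⟨?_, ?_, by omega⟩
  · unfold Feasible
    rw [reveal_eq_of_subset I w hBA] at hA ⊢
    exact hB.solved_of_cover hI.nonempty (hI.consistent_reveal B) hA hR.1
      (Finset.union_subset_right hsub)
  · unfold Paid at hp
    have h2 := Nat.mul_le_mul_left γ hcard
    have h3 := Nat.mul_le_mul_left γ hRO
    have h4 := Nat.mul_le_mul hc hMH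
    nlinarith

/-! ### Termination measure -/

open Classical in
/-- A bound for the number of moves without a query that can follow. -/
noncomputable def hopRank (J : UncertainInstance V) : HopState V → ℕ
  | .initMand => 10
  | .predPhase _ => if ∃ v, J.PredMandatory v then 2 else 9
  | .predMand _ => 10
  | .branch => if ∃ v, J.PredMandatory v then 1 else 8
  | .askSecond _ _ _ => 0
  | .askThird _ _ => 7
  | .loopMand => 6
  | .loopTest => 5
  | .coverStart => 4
  | .cover _ => 3
  | .finalMand => 2
  | .halted => 0

theorem hopRank_le (J : UncertainInstance V) (a : HopState V) : J.hopRank a ≤ 10 := by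
  cases a <;> simp only [hopRank] <;> (try split_ifs) <;> omega

/-- The only danger is a queryless round of the main loop. While a prediction mandatory vertex
exists, the branching cannot pass without a query, so in that case `.predPhase` and `.branch` can be
ranked below `.loopTest`. -/
theorem HopInv.hopRank_lt (hI : I.Admissible w OPT) {a a' : HopState V}
    (h : I.HopInv w OPT γ c a A) (ht : HopTrans γ a (I.reveal w A) none a') :
    (I.reveal w A).hopRank a' < (I.reveal w A).hopRank a := by
  cases ht with
  | branch_none hno =>
    have : ¬ ∃ v, (I.reveal w A).PredMandatory v := fun ⟨v, hv⟩ => hno (hI.exists_enforces h.1 hv)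
    simp [hopRank, this]
  | loop_again hpm => simp [hopRank, hpm]
  | _ =>
    simp only [hopRank]
    (try split_ifs) <;> omega

end UncertainInstance

/-! ### Executions: termination, progress and final bounds -/

namespace QueryAlgorithm

open UncertainInstance

variable {V : Type u} [Fintype V] [DecidableEq V] {I : UncertainInstance V} {w : V → ℝ}
  {OPT : Finset V} {γ c : ℕ}

/-- The invariant for configurations. -/
def ConfigInv (I : UncertainInstance V) (w : V → ℝ) (OPT : Finset V) (γ c : ℕ)
    (C : (hopAlgorithm V γ).Config) : Prop :=
  C.asked.Nodup ∧ I.HopInv w OPT γ c C.state C.asked.toFinset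

/-- An unqueried vertex weighs 11, more than the largest rank 10, so a query decreases the measure
whatever state follows. -/
theorem ConfigInv.step (hI : I.Admissible w OPT) (hγ : 2 ≤ γ) (hc : γ ≤ c)
    (hc' : 2 < γ → γ + 1 ≤ c) {C C' : (hopAlgorithm V γ).Config}
    (h : ConfigInv I w OPT γ c C) (hs : (hopAlgorithm V γ).Step I w C C') :
    ConfigInv I w OPT γ c C' ∧
      (Fintype.card V - C'.asked.length) * 11 + (I.reveal w C'.asked.toFinset).hopRank C'.state <
        (Fintype.card V - C.asked.length) * 11 +
          (I.reveal w C.asked.toFinset).hopRank C.state := by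
  obtain ⟨q, ht, ha⟩ := hs
  obtain ⟨h1, h2⟩ := h.2.step hI hγ hc hc' ht
  obtain ⟨a', l'⟩ := C'
  simp only at ha ht h2 ⊢
  subst ha
  cases q with
  | none => exact ⟨⟨h.1, by simpa using h2⟩, by simpa using h.2.hopRank_lt hI ht⟩
  | some v =>
    have hv : v ∉ C.asked := by simpa using h1
    have hn : (v :: C.asked).Nodup := List.nodup_cons.2 ⟨hv, h.1⟩
    refine ⟨⟨hn, by simpa using h2⟩, ?_⟩
    have h3 := hn.length_le_card
    have h4 := hopRank_le (I.reveal w (v :: C.asked).toFinset) a'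
    simp only [Option.toList_some, List.singleton_append, List.length_cons] at h3 h4 ⊢
    omega

theorem ConfigInv.acc (hI : I.Admissible w OPT) (hγ : 2 ≤ γ) (hc : γ ≤ c)
    (hc' : 2 < γ → γ + 1 ≤ c) (n : ℕ) : ∀ C : (hopAlgorithm V γ).Config,
    ConfigInv I w OPT γ c C → (Fintype.card V - C.asked.length) * 11 +
      (I.reveal w C.asked.toFinset).hopRank C.state < n →
    Acc (fun C' C => (hopAlgorithm V γ).Step I w C C') C := by
  induction n with
  | zero => intro C _ h; omega
  | succ n ih =>
    intro C hC h
    refine ⟨C, fun C' hs => ?_⟩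
    obtain ⟨h1, h2⟩ := hC.step hI hγ hc hc' hs
    exact ih C' h1 (by omega)

/-- The algorithm is never stuck. -/
theorem exists_hopTrans (γ : ℕ) (a : HopState V) (J : UncertainInstance V) (h : a ≠ .halted) :
    ∃ q a', HopTrans γ a J q a' := by
  have known : (∃ v, J.KnownMandatory v) ∨ ¬ ∃ v, J.KnownMandatory v := em _
  cases a with
  | initMand =>
    rcases known with ⟨v, hv⟩ | hv
    exacts [⟨_, _, .init_query hv⟩, ⟨_, _, .init_exit hv⟩]
  | predPhase Q =>
    by_cases h : (∃ u, J.PredMandatory u) ∧ Q.card + 2 < γ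
    · obtain ⟨⟨u, hu⟩, hQ⟩ := h
      exact ⟨_, _, .pred_query hu hQ⟩
    · exact ⟨_, _, .pred_exit h⟩
  | predMand Q =>
    rcases known with ⟨v, hv⟩ | hv
    exacts [⟨_, _, .predMand_query hv⟩, ⟨_, _, .predMand_exit hv⟩]
  | branch =>
    by_cases h : ∃ u v x, J.Enforces u v ∧ J.WitnessPair u x ∧ v ≠ x
    · obtain ⟨u, v, x, h1, h2, h3⟩ := h
      exact ⟨_, _, .branch_triple h1 h2 h3⟩
    · by_cases h' : ∃ u v, J.Enforces u v
      · obtain ⟨u, v, h'⟩ := h'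
        exact ⟨_, _, .branch_pair h h'⟩
      · exact ⟨_, _, .branch_none h'⟩
  | askSecond u v x => exact ⟨_, _, .second_query⟩
  | askThird u v =>
    by_cases h : J.lo u ∈ J.interval v
    exacts [⟨_, _, .third_query h⟩, ⟨_, _, .third_skip h⟩]
  | loopMand =>
    rcases known with ⟨v, hv⟩ | hv
    exacts [⟨_, _, .loopMand_query hv⟩, ⟨_, _, .loopMand_exit hv⟩]
  | loopTest =>
    by_cases h : ∃ v, J.PredMandatory v
    exacts [⟨_, _, .loop_again h⟩, ⟨_, _, .loop_exit h⟩]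
  | coverStart =>
    obtain ⟨R, hR⟩ := J.exists_isMinCover
    exact ⟨_, _, .cover_start hR⟩
  | cover R =>
    rcases R.eq_empty_or_nonempty with rfl | ⟨v, hv⟩
    exacts [⟨_, _, .cover_exit⟩, ⟨_, _, .cover_query hv⟩]
  | finalMand =>
    rcases known with ⟨v, hv⟩ | hv
    exacts [⟨_, _, .final_query hv⟩, ⟨_, _, .final_exit hv⟩]
  | halted => exact absurd rfl h

theorem hopAlgorithm_solvesWithin (hI : I.Admissible w OPT) (hγ : 2 ≤ γ) (hc : γ ≤ c)
    (hc' : 2 < γ → γ + 1 ≤ c) {b : ℝ}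
    (hb : ∀ n : ℕ, γ * n ≤ (γ + 1) * OPT.card + c * I.hopDistance w → n ≤ γ * OPT.card →
      (n : ℝ) ≤ b) : (hopAlgorithm V γ).SolvesWithin I w b := by
  have h0 : ConfigInv I w OPT γ c (hopAlgorithm V γ).init :=
    ⟨List.nodup_nil, show (∅ : Finset V) ⊆ OPT by simp⟩
  refine ⟨ConfigInv.acc hI hγ hc hc' _ _ h0 (Nat.lt_succ_self _), fun C hC => ?_⟩
  have hC' : ConfigInv I w OPT γ c C := by
    induction hC with
    | refl => exact h0
    | tail _ hs ih => exact (ih.step hI hγ hc hc' hs).1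
  refine ⟨fun h => ?_, fun h => ?_⟩
  · obtain ⟨q, a', ht⟩ := exists_hopTrans γ C.state (I.reveal w C.asked.toFinset) h
    exact ⟨⟨a', q.toList ++ C.asked⟩, q, ht, rfl⟩
  · have h1 := hC'.2
    rw [h] at h1
    obtain ⟨h1, h2, h3⟩ := h1.halted_bounds hI hc
    rw [List.toFinset_card_of_nodup hC'.1] at h2 h3
    exact ⟨h1, hb _ h2 h3⟩

end QueryAlgorithm

/-- For `|OPT| = 0` both bounds are `0`: no query is made. -/
theorem theorem3p1 (γ : ℕ) (hγ : 2 ≤ γ) {V : Type u} [Fintype V] [DecidableEq V]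
    (I : UncertainInstance V) (hI : I.WellFormed) (w : V → ℝ) (hw : I.Consistent w)
    (OPT : Finset V) (hOPT : I.IsOptimal w OPT) :
    (hopAlgorithm V γ).SolvesWithin I w
      (min ((1 + 1 / (γ : ℝ)) * (1 + (I.hopDistance w : ℝ) / (OPT.card : ℝ))) (γ : ℝ)
        * (OPT.card : ℝ)) ∧
    (γ = 2 → (hopAlgorithm V γ).SolvesWithin I w
      (min (1.5 + (I.hopDistance w : ℝ) / (OPT.card : ℝ)) 2 * (OPT.card : ℝ))) := by
  have hA : I.Admissible w OPT := ⟨hI.1, hI.2, hw, hOPT.1⟩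
  refine ⟨QueryAlgorithm.hopAlgorithm_solvesWithin (c := γ + 1) hA hγ (by omega) (by omega)
    fun n h1 h2 => ?_, ?_⟩
  · have h1 : (γ : ℝ) * n ≤ (γ + 1) * OPT.card + (γ + 1) * I.hopDistance w := by exact_mod_cast h1
    have h2 : (n : ℝ) ≤ γ * OPT.card := by exact_mod_cast h2
    have hγ' : (0 : ℝ) < γ := by positivity
    -- For an empty optimum the quotient takes its default value 0 and the factor `OPT.card` makes
    -- the bound 0; robustness then forces `n = 0`.
    rcases OPT.card.eq_zero_or_pos with h0 | h0
    · simpa [h0] using h2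
    · have h0 : (0 : ℝ) < OPT.card := by exact_mod_cast h0
      rw [min_mul_of_nonneg _ _ h0.le]
      refine le_min ?_ h2
      field_simp
      linarith
  · rintro rfl
    -- For γ = 2 the inner loop makes no query, so a hop need only pay γ = 2; this yields the
    -- additive term with coefficient 1.
    refine QueryAlgorithm.hopAlgorithm_solvesWithin (c := 2) hA hγ le_rfl (by omega)
      fun n h1 h2 => ?_
    have h1 : (2 : ℝ) * n ≤ (2 + 1) * OPT.card + 2 * I.hopDistance w := by exact_mod_cast h1
    have h2 : (n : ℝ) ≤ 2 * OPT.card := by exact_mod_cast h2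
    rcases OPT.card.eq_zero_or_pos with h0 | h0
    · simpa [h0] using h2
    · have h0 : (0 : ℝ) < OPT.card := by exact_mod_cast h0
      rw [min_mul_of_nonneg _ _ h0.le, add_mul, div_mul_cancel₀ _ h0.ne']
      exact le_min (by linarith) h2
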